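/- **Setting.** Let $C_{L_1},C_{L_2}$ be proper, $G$ strictly proper and $\mathcal C_s$ proper and stable real SISO transfer functions, each given by a finite-dimensional state-space realization. Let $\omega_r>0$, $\xi>0$, $-1<\gamma<1$. The second order single state reset element (SOSRE) has base system $$A_r=\begin{bmatrix}-2\xi\omega_r&-\omega_r^2\\1&0\end{bmatrix},\quad B_r=\begin{bmatrix}1\\0\end{bmatrix},\quad C_r=\begin{bmatrix}0&1\end{bmatrix},\quad D_r=0,$$ base transfer function $C_R(s)=1/(s^2+2\xi\omega_rs+\omega_r^2)$ and reset matrix $A_\rho=\mathrm{diag}(\gamma,1)$. Consider the loop $e=r-y$, $u_1=C_{L_1}e$, $e_r=\mathcal C_s u_1$, $u_r=$ output of the SOSRE with input $u_1$, $y=G(C_{L_2}u_r+d)$, with external input $w=(r,d)$. With $x=(x_r,\zeta)$, where $x_r$ is the state of the reset element and $\zeta$ that of the linear blocks, it is $$\dot x=\bar Ax+\bar Bw,\qquad x(t^+)=\bar A_\rho x(t)\ \text{ if } e_r(t)=0 \text{ and } (I-\bar A_\rho)x(t)\neq0,\qquad e_r=\bar C_ex+D_er,$$ $\bar A_\rho=\mathrm{diag}(A_\rho,I)$.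 A reset instant of a left-continuous solution on $[t_0,\infty)$ is a time $t>t_0$ with $e_r(t)=0$ and $(I-\bar A_\rho)x(t)\ne0$. A Bohl function is a real linear combination of functions $t^ke^{at}\cos(bt)$ and $t^ke^{at}\sin(bt)$ on $[0,\infty)$. Put $L=C_{L_1}C_RC_{L_2}G$ and $\kappa(j\omega)=1+\overline{L(j\omega)}$, and suppose that $L$ has no pole $j\omega$ with $\omega>0$. Let $\Omega=[0,\infty)$ if $L$ has no pole at $0$, and $\Omega=(0,\infty)$ otherwise. For $\omega\in\Omega$ define the Nyquist stability vector $$\mathcal N_\chi(\omega)=\Re\big(L(j\omega)\kappa(j\omega)\mathcal C_s(j\omega)\big),\qquad \mathcal N_\Upsilon(\omega)=-\Im\big(\omega\,\kappa(j\omega)C_R(j\omega)\big),$$ and let $\mathcal I_1,\dots,\mathcal I_4\subseteq\Omega$ be the sets of frequencies at which $(\mathcal N_\chi,\mathcal N_\Upsilon)$ lies in the open first, ..., fourth quadrant. The system is of *Type I* if: (1) if $C_{L_1}C_{L_2}G$ has a pole at the origin, then $\mathcal C_s(0)>0$; (2) $\mathcal N_\Upsilon(\omega)>0$ whenever $\omega\in\Omega$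 and $\mathcal N_\chi(\omega)=0$; (3) $\mathcal N_\chi(\omega)>0$ whenever $\omega\in\Omega$ and $\mathcal N_\Upsilon(\omega)=0$; (4) $\mathcal N_\Upsilon\ge0$ on $\Omega$, or $\mathcal N_\chi\ge0$ on $\Omega$, or $\mathcal I_3=\varnothing$ and $\sup_{\mathcal I_4}|\mathcal N_\Upsilon/\mathcal N_\chi|<\inf_{\mathcal I_2}|\mathcal N_\Upsilon/\mathcal N_\chi|$. It is of *Type II* if: (1) if $C_{L_1}C_{L_2}G$ has a pole at the origin, then $\mathcal C_s(0)<0$; (2) $\mathcal N_\Upsilon(\omega)>0$ whenever $\omega\in\Omega$ and $\mathcal N_\chi(\omega)=0$; (3) $\mathcal N_\chi(\omega)<0$ whenever $\omega\in\Omega$ and $\mathcal N_\Upsilon(\omega)=0$; (4) $\mathcal N_\Upsilon\ge0$ on $\Omega$, or $\mathcal N_\chi\le0$ on $\Omega$, or $\mathcal I_4=\varnothing$ and $\sup_{\mathcal I_3}|\mathcal N_\Upsilon/\mathcal N_\chi|<\inf_{\mathcal I_1}|\mathcal N_\Upsilon/\mathcal N_\chi|$. (Here $\sup\varnothing=0$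 and $\inf\varnothing=\infty$.) **Statement.** Let $\mathcal W$ be a set of Bohl inputs with $0\in\mathcal W$ (for instance, all of them) for which the reset instants are well posed: for every $t_0\ge0$, every initial condition, every $w\in\mathcal W$ and every solution on $[t_0,\infty)$ there is $\lambda>0$ such that distinct reset instants are at least $\lambda$ apart. Suppose that the base linear system is stable ($\bar A$ is Hurwitz), that the open-loop transfer function $L$ has no pole-zero cancellation (the product of the numerators $c\,\mathrm{adj}(sI-A)b+d\det(sI-A)$ of its blocks is coprime to the product of their denominators $\det(sI-A)$), and that the system is of Type I or of Type II (or both). Then * the zero equilibrium is globally uniformly asymptotically stable for $w=0$: it is uniformly stable, solutions are bounded uniformly for $x_0$ in bounded sets, and they converge to zero uniformly in $t_0\ge0$ and in $x_0$ in bounded sets; * the system is uniformly bounded-input bounded-state for inputs in $\mathcal W$: for every $R>0$ there is $K>0$ such that every solution on $[t_0,\infty)$, $t_0\ge0$, with $w\in\mathcal W$, $\|x_0\|\le R$ and $\sup_{t\ge0}\|w(t)\|\le R$ satisfies $\|x(t)\|\le K$ for all $t\ge t_0$. -/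

import Mathlib

open Filter Topology Polynomial

noncomputable section

namespace ResetControl

/-! ### Linear blocks -/

/-- A real square matrix is Hurwitz: all its complex eigenvalues have negative real part. -/
def IsHurwitz {n : Type*} [Fintype n] [DecidableEq n] (M : Matrix n n ℝ) : Prop :=
  ∀ s : ℂ, (M.charpoly.map (algebraMap ℝ ℂ)).IsRoot s → s.re < 0

/-- A finite-dimensional single-input single-output linear time-invariant system
`x' = A x + b u`, `y = c x + d u`.  It is strictly proper when `d = 0`. -/
structure LTI (n : Type*) where
  A : Matrix n n ℝ
  b : n → ℝ
  c : n → ℝ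
  d : ℝ

namespace LTI

variable {n : Type*} [Fintype n] [DecidableEq n]

/-- The transfer function `c (s I - A)⁻¹ b + d`. -/
def tf (S : LTI n) (s : ℂ) : ℂ :=
  (fun i => (S.c i : ℂ)) ⬝ᵥ
      (((Matrix.scalar n s - S.A.map (algebraMap ℝ ℂ))⁻¹).mulVec (fun i => (S.b i : ℂ))) + S.d

/-- The denominator polynomial `det (X I - A)` of the transfer function. -/
def den (S : LTI n) : ℝ[X] := S.A.charpoly

/-- The numerator polynomial `c adj (X I - A) b + d det (X I - A)` of the transfer function. -/
def num (S : LTI n) : ℝ[X] :=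
  (fun i => C (S.c i)) ⬝ᵥ (S.A.charmatrix.adjugate.mulVec (fun i => C (S.b i))) + C S.d * S.den

end LTI

/-! ### The reset element -/

/-- A reset element: a linear system together with a reset matrix. -/
structure ResetElement (m : Type*) extends LTI m where
  Aρ : Matrix m m ℝ

/-- The second order single state reset element: the element with base transfer function
`1 / (s ^ 2 + 2 ξ ωr s + ωr ^ 2)` in controllable canonical form, with reset matrix
`diag (γ, 1)`. -/
def sosre (ξ ωr γ : ℝ) : ResetElement (Fin 2) where
  A := !![-(2 * ξ * ωr), -(ωr ^ 2); 1, 0]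
  b := ![1, 0]
  c := ![0, 1]
  d := 0
  Aρ := !![γ, 0; 0, 1]

/-! ### The linear part of the loop -/

/-- The linear part of a reset control loop, with state `ζ`, input `u_r`, external input
`w = (r, d)` and outputs `y`, `e_r`, `u₁`:
`ζ' = A ζ + Bu u_r + B w`, `y = C ζ`, `e_r = Ce ζ + De r`, `u₁ = Cu ζ + D₁ r`. -/
structure LinearPart (n : Type*) where
  A : Matrix n n ℝ
  Bu : n → ℝ
  B : Matrix n (Fin 2) ℝ
  C : n → ℝ
  Ce : n → ℝ
  De : ℝ
  Cu : n → ℝ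
  D₁ : ℝ

/-- The linear part of the control loop
`e = r - y`, `u₁ = C_{L1} e`, `e_r = C_s u₁`, `y = G (C_{L2} u_r + d)`,
for a strictly proper plant `G`.  The state is `(x_G, x_{L1}, x_{L2}, x_s)`. -/
def linearPart {ιG ι₁ ι₂ ιs : Type*} (G : LTI ιG) (CL₁ : LTI ι₁) (CL₂ : LTI ι₂) (Cs : LTI ιs) :
    LinearPart (ιG ⊕ ι₁ ⊕ ι₂ ⊕ ιs) where
  A := Matrix.of fun
    | .inl i, .inl j => G.A i j
    | .inl i, .inr (.inr (.inl j)) => G.b i * CL₂.c j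
    | .inr (.inl i), .inl j => -(CL₁.b i * G.c j)
    | .inr (.inl i), .inr (.inl j) => CL₁.A i j
    | .inr (.inr (.inl i)), .inr (.inr (.inl j)) => CL₂.A i j
    | .inr (.inr (.inr i)), .inl j => -(Cs.b i * CL₁.d * G.c j)
    | .inr (.inr (.inr i)), .inr (.inl j) => Cs.b i * CL₁.c j
    | .inr (.inr (.inr i)), .inr (.inr (.inr j)) => Cs.A i j
    | _, _ => 0
  Bu := fun
    | .inl i => G.b i * CL₂.d
    | .inr (.inr (.inl i)) => CL₂.b i
    | _ => 0
  B := Matrix.of fun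
    | .inl i => ![0, G.b i]
    | .inr (.inl i) => ![CL₁.b i, 0]
    | .inr (.inr (.inl _)) => ![0, 0]
    | .inr (.inr (.inr i)) => ![Cs.b i * CL₁.d, 0]
  C := fun
    | .inl j => G.c j
    | _ => 0
  Ce := fun
    | .inl j => -(Cs.d * CL₁.d * G.c j)
    | .inr (.inl j) => Cs.d * CL₁.c j
    | .inr (.inr (.inl _)) => 0
    | .inr (.inr (.inr j)) => Cs.c j
  De := Cs.d * CL₁.d
  Cu := fun
    | .inl j => -(CL₁.d * G.c j)
    | .inr (.inl j) => CL₁.c j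
    | _ => 0
  D₁ := CL₁.d

/-! ### The closed loop and its solutions -/

/-- A reset control system with state space `N → ℝ` and external input `w = (r, d)`:
`x' = A x + B w` away from the reset instants, `x(t⁺) = Aρ x(t)` when
`e_r(t) = 0` and `(I - Aρ) x(t) ≠ 0`, where `e_r = Ce x + De r`; the output is `y = C x`. -/
structure ResetSystem (N : Type*) where
  A : Matrix N N ℝ
  B : Matrix N (Fin 2) ℝ
  Aρ : Matrix N N ℝ
  C : N → ℝ
  Ce : N → ℝ
  De : ℝ

/-- The closed loop of a reset element and a linear part; the state is `(x_r, ζ)`. -/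
def closedLoop {m n : Type*} [DecidableEq n] (R : ResetElement m) (P : LinearPart n) :
    ResetSystem (m ⊕ n) where
  A := Matrix.fromBlocks R.A (Matrix.vecMulVec R.b P.Cu)
    (Matrix.vecMulVec P.Bu R.c) (P.A + R.d • Matrix.vecMulVec P.Bu P.Cu)
  B := Matrix.of fun
    | .inl i => ![R.b i * P.D₁, 0]
    | .inr i => ![P.B i 0 + P.Bu i * R.d * P.D₁, P.B i 1]
  Aρ := Matrix.fromBlocks R.Aρ 0 0 1
  C := Sum.elim 0 P.C
  Ce := Sum.elim 0 P.Ce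
  De := P.De

namespace ResetSystem

variable {N : Type*} [Fintype N] [DecidableEq N]

/-- The reset triggering signal `e_r`. -/
def er (S : ResetSystem N) (w : ℝ → Fin 2 → ℝ) (x : ℝ → N → ℝ) (t : ℝ) : ℝ :=
  S.Ce ⬝ᵥ x t + S.De * w t 0

/-- The reset instants of a trajectory that starts at time `t₀`. -/
def resetInstants (S : ResetSystem N) (t₀ : ℝ) (w : ℝ → Fin 2 → ℝ) (x : ℝ → N → ℝ) : Set ℝ :=
  {t | t₀ < t ∧ S.er w x t = 0 ∧ (1 - S.Aρ).mulVec (x t) ≠ 0}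

/-- `x` is a (left-continuous) solution on `[t₀, ∞)` with initial condition `x₀` and input `w`.
Since `x` is left-continuous, the flow equation is imposed through the right derivative;
on every open interval without reset instants it then holds with the two-sided derivative. -/
structure IsSolution (S : ResetSystem N) (t₀ : ℝ) (x₀ : N → ℝ) (w : ℝ → Fin 2 → ℝ)
    (x : ℝ → N → ℝ) : Prop where
  init : x t₀ = x₀
  left_cont : ∀ t, t₀ < t → ContinuousWithinAt x (Set.Iic t) t
  flow : ∀ t, t₀ ≤ t → t ∉ S.resetInstants t₀ w x →
    HasDerivWithinAt x (S.A.mulVec (x t) + S.B.mulVec (w t)) (Set.Ici t) t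
  jump : ∀ t ∈ S.resetInstants t₀ w x, Tendsto x (𝓝[>] t) (𝓝 (S.Aρ.mulVec (x t)))

/-- Well-posedness of the reset instants for the inputs in `𝒲`: for every initial condition
and every input in `𝒲` the distances of distinct reset instants are bounded below by some
`lam > 0`, which may depend on the trajectory. -/
def WellPosedResets (S : ResetSystem N) (𝒲 : Set (ℝ → Fin 2 → ℝ)) : Prop :=
  ∀ w ∈ 𝒲, ∀ t₀ : ℝ, 0 ≤ t₀ → ∀ (x₀ : N → ℝ) (x : ℝ → N → ℝ), S.IsSolution t₀ x₀ w x →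
    ∃ lam : ℝ, 0 < lam ∧ ∀ s ∈ S.resetInstants t₀ w x, ∀ t ∈ S.resetInstants t₀ w x,
      s < t → lam ≤ t - s

/-- The zero equilibrium is globally uniformly asymptotically stable for `w = 0`:
zero is an equilibrium, it is uniformly stable, solutions are uniformly bounded, and
zero is globally uniformly attractive. -/
def IsGUAS (S : ResetSystem N) : Prop :=
  (∀ t₀ : ℝ, 0 ≤ t₀ → S.IsSolution t₀ 0 0 (fun _ => 0)) ∧
  (∀ ε : ℝ, 0 < ε → ∃ δ : ℝ, 0 < δ ∧ ∀ t₀ : ℝ, 0 ≤ t₀ → ∀ (x₀ : N → ℝ) (x : ℝ → N → ℝ),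
    S.IsSolution t₀ x₀ 0 x → ‖x₀‖ ≤ δ → ∀ t, t₀ ≤ t → ‖x t‖ ≤ ε) ∧
  (∀ R : ℝ, 0 < R → ∃ K : ℝ, 0 < K ∧ ∀ t₀ : ℝ, 0 ≤ t₀ → ∀ (x₀ : N → ℝ) (x : ℝ → N → ℝ),
    S.IsSolution t₀ x₀ 0 x → ‖x₀‖ ≤ R → ∀ t, t₀ ≤ t → ‖x t‖ ≤ K) ∧
  (∀ R : ℝ, 0 < R → ∀ ε : ℝ, 0 < ε → ∃ T : ℝ, 0 < T ∧
    ∀ t₀ : ℝ, 0 ≤ t₀ → ∀ (x₀ : N → ℝ) (x : ℝ → N → ℝ),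
      S.IsSolution t₀ x₀ 0 x → ‖x₀‖ ≤ R → ∀ t, t₀ + T ≤ t → ‖x t‖ ≤ ε)

/-- Uniform bounded-input bounded-state property for the inputs in `𝒲`: a bound on the initial
condition and on the input gives a bound on the state that depends on nothing else. -/
def IsUBIBS (S : ResetSystem N) (𝒲 : Set (ℝ → Fin 2 → ℝ)) : Prop :=
  ∀ R : ℝ, 0 < R → ∃ K : ℝ, 0 < K ∧ ∀ w ∈ 𝒲, (∀ t, 0 ≤ t → ‖w t‖ ≤ R) →
    ∀ t₀ : ℝ, 0 ≤ t₀ → ∀ (x₀ : N → ℝ) (x : ℝ → N → ℝ),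
      S.IsSolution t₀ x₀ w x → ‖x₀‖ ≤ R → ∀ t, t₀ ≤ t → ‖x t‖ ≤ K

end ResetSystem

/-- Bohl functions on `[0, ∞)`: real parts of finite linear combinations of the functions
`t ^ k * exp (μ t)` with complex coefficients and complex `μ`, that is, linear combinations of
`t ^ k * exp (a t) * cos (b t)` and `t ^ k * exp (a t) * sin (b t)`. -/
def IsBohl (f : ℝ → ℝ) : Prop :=
  ∃ (N : ℕ) (a μ : Fin N → ℂ) (k : Fin N → ℕ), ∀ t : ℝ, 0 ≤ t →
    f t = (∑ i, a i * (t : ℂ) ^ k i * Complex.exp (μ i * t)).re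

/-! ### The open loop and the Nyquist stability vector -/

section OpenLoop

variable {ιG ι₁ ι₂ ιs m : Type*} [Fintype ιG] [DecidableEq ιG] [Fintype ι₁] [DecidableEq ι₁]
  [Fintype ι₂] [DecidableEq ι₂] [Fintype ιs] [DecidableEq ιs] [Fintype m] [DecidableEq m]

/-- Numerator of the open-loop transfer function before any cancellation. -/
def openLoopNum (CR : LTI m) (G : LTI ιG) (CL₁ : LTI ι₁) (CL₂ : LTI ι₂) : ℝ[X] :=
  CL₁.num * CR.num * CL₂.num * G.num

/-- Denominator of the open-loop transfer function before any cancellation. -/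
def openLoopDen (CR : LTI m) (G : LTI ιG) (CL₁ : LTI ι₁) (CL₂ : LTI ι₂) : ℝ[X] :=
  CL₁.den * CR.den * CL₂.den * G.den

/-- The open-loop transfer function has no pole-zero cancellation.  In particular its poles are
exactly the roots of `openLoopDen`. -/
def NoPoleZeroCancellation (CR : LTI m) (G : LTI ιG) (CL₁ : LTI ι₁) (CL₂ : LTI ι₂) : Prop :=
  IsCoprime (openLoopNum CR G CL₁ CL₂) (openLoopDen CR G CL₁ CL₂)

/-- The point `j ω` is a root of the open-loop denominator. -/
def HasPoleAt (CR : LTI m) (G : LTI ιG) (CL₁ : LTI ι₁) (CL₂ : LTI ι₂) (ω : ℝ) : Prop :=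
  aeval (Complex.I * ω) (openLoopDen CR G CL₁ CL₂) = 0

/-- The frequencies `ω ≥ 0` at which the open-loop transfer function is finite. -/
def freqs (CR : LTI m) (G : LTI ιG) (CL₁ : LTI ι₁) (CL₂ : LTI ι₂) : Set ℝ :=
  {ω | 0 ≤ ω ∧ ¬ HasPoleAt CR G CL₁ CL₂ ω}

/-- `C_{L1} C_{L2} G` has a pole at the origin (in the absence of pole-zero cancellation). -/
def PoleAtOrigin (G : LTI ιG) (CL₁ : LTI ι₁) (CL₂ : LTI ι₂) : Prop :=
  (CL₁.den * CL₂.den * G.den).IsRoot 0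

/-- The open-loop transfer function `L = C_{L1} C_R C_{L2} G`. -/
def openLoop (CR : LTI m) (G : LTI ιG) (CL₁ : LTI ι₁) (CL₂ : LTI ι₂) (s : ℂ) : ℂ :=
  CL₁.tf s * CR.tf s * CL₂.tf s * G.tf s

/-- `κ(j ω) = 1 + conj (L(j ω))`. -/
def kappa (CR : LTI m) (G : LTI ιG) (CL₁ : LTI ι₁) (CL₂ : LTI ι₂) (ω : ℝ) : ℂ :=
  1 + (starRingEnd ℂ) (openLoop CR G CL₁ CL₂ (Complex.I * ω))

/-- First component `Re (L κ C_s)` of the Nyquist stability vector. -/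
def nsvChi (CR : LTI m) (G : LTI ιG) (CL₁ : LTI ι₁) (CL₂ : LTI ι₂) (Cs : LTI ιs) (ω : ℝ) : ℝ :=
  (openLoop CR G CL₁ CL₂ (Complex.I * ω) * kappa CR G CL₁ CL₂ ω * Cs.tf (Complex.I * ω)).re

/-- Second component `-Im (ω κ C_R)` of the Nyquist stability vector for second order single
state reset elements. -/
def nsvUpsilon (CR : LTI m) (G : LTI ιG) (CL₁ : LTI ι₁) (CL₂ : LTI ι₂) (ω : ℝ) : ℝ :=
  -((ω : ℂ) * kappa CR G CL₁ CL₂ ω * CR.tf (Complex.I * ω)).im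

/-- The constant coefficient of the numerator of `C_s`, when the constant coefficient of its
denominator is normalized to `1`; that is, `C_s(0)`. -/
def filterDC (Cs : LTI ιs) : ℝ := (Cs.tf 0).re

end OpenLoop

/-! ### Systems of Type I and of Type II

`Ω` is the set of frequencies, `Nχ`, `NΥ` are the components of the Nyquist stability vector,
`pole` says that `C_{L1} C_{L2} G` has a pole at the origin, `Ks₀ = C_s(0)`. -/

/-- Frequencies at which the vector lies in the open first quadrant. -/
def quad₁ (Ω : Set ℝ) (Nχ NΥ : ℝ → ℝ) : Set ℝ := {ω ∈ Ω | 0 < Nχ ω ∧ 0 < NΥ ω}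

/-- Frequencies at which the vector lies in the open second quadrant. -/
def quad₂ (Ω : Set ℝ) (Nχ NΥ : ℝ → ℝ) : Set ℝ := {ω ∈ Ω | Nχ ω < 0 ∧ 0 < NΥ ω}

/-- Frequencies at which the vector lies in the open third quadrant. -/
def quad₃ (Ω : Set ℝ) (Nχ NΥ : ℝ → ℝ) : Set ℝ := {ω ∈ Ω | Nχ ω < 0 ∧ NΥ ω < 0}

/-- Frequencies at which the vector lies in the open fourth quadrant. -/
def quad₄ (Ω : Set ℝ) (Nχ NΥ : ℝ → ℝ) : Set ℝ := {ω ∈ Ω | 0 < Nχ ω ∧ NΥ ω < 0}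

/-- `sup |NΥ / Nχ|` over a set of frequencies, in `[0, ∞]` (it is `0` on the empty set). -/
def slopeSup (s : Set ℝ) (Nχ NΥ : ℝ → ℝ) : ENNReal := ⨆ ω ∈ s, ENNReal.ofReal |NΥ ω / Nχ ω|

/-- `inf |NΥ / Nχ|` over a set of frequencies, in `[0, ∞]` (it is `∞` on the empty set). -/
def slopeInf (s : Set ℝ) (Nχ NΥ : ℝ → ℝ) : ENNReal := ⨅ ω ∈ s, ENNReal.ofReal |NΥ ω / Nχ ω|

/-- Type I, for a reset element that is not a Clegg integrator. -/
def IsTypeI (Ω : Set ℝ) (Nχ NΥ : ℝ → ℝ) (pole : Prop) (Ks₀ : ℝ) : Prop :=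
  (pole → 0 < Ks₀) ∧
  (∀ ω ∈ Ω, Nχ ω = 0 → 0 < NΥ ω) ∧
  (∀ ω ∈ Ω, NΥ ω = 0 → 0 < Nχ ω) ∧
  ((∀ ω ∈ Ω, 0 ≤ NΥ ω) ∨ (∀ ω ∈ Ω, 0 ≤ Nχ ω) ∨
    (slopeSup (quad₄ Ω Nχ NΥ) Nχ NΥ < slopeInf (quad₂ Ω Nχ NΥ) Nχ NΥ ∧ quad₃ Ω Nχ NΥ = ∅))

/-- Type II, for a reset element that is not a Clegg integrator. -/
def IsTypeII (Ω : Set ℝ) (Nχ NΥ : ℝ → ℝ) (pole : Prop) (Ks₀ : ℝ) : Prop :=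
  (pole → Ks₀ < 0) ∧
  (∀ ω ∈ Ω, Nχ ω = 0 → 0 < NΥ ω) ∧
  (∀ ω ∈ Ω, NΥ ω = 0 → Nχ ω < 0) ∧
  ((∀ ω ∈ Ω, 0 ≤ NΥ ω) ∨ (∀ ω ∈ Ω, Nχ ω ≤ 0) ∨
    (slopeSup (quad₃ Ω Nχ NΥ) Nχ NΥ < slopeInf (quad₁ Ω Nχ NΥ) Nχ NΥ ∧ quad₄ Ω Nχ NΥ = ∅))

end ResetControl

end

open Filter Topology Polynomial

noncomputable section

namespace ResetControl

/-! The proof builds one quadratic Lyapunov function `V x = x ⬝ᵥ (P *ᵥ x)` that decreases along the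
flow and is controlled at resets. A reset moves the state only along the unit vector `e` of the
reset coordinate, so the change of `V` depends on `P` through `P e`. If `P e = e + β • Ce`, the
condition `e_r = 0` replaces `Ce ⬝ᵥ x` by `-De * r`: without input, `V` drops by `(1 - γ ^ 2)` times
the square of the reset coordinate; with input, it gains at most a term linear in that coordinate.

Such a `P` exists, by a strict positive real lemma (`exists_lyapunov_of_strictly_positive_real`),
once the transfer function from `e` to `c = e + β • Ce` has positive real part on the imaginary axis
and `c ⬝ᵥ A e < 0`. The latter number is `-2 ξ ωr`. No controllability is available, so the lemma is
proved by convex duality: Hahn–Banach separation, with covariance matrices as dual objects. That `P`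
is positive definite follows from `A` being Hurwitz (`IsHurwitz.lyapunov_pos`).

Exciting `e` by a unit amplitude gives `x₂ = C_R / (1 + L)`, `x₁ = s x₂` and `e_r = -C_s L / (1 +
L)`. Multiplying by `|1 + L| ^ 2 = (1 + L) κ` shows that `NΥ` and `Nχ` are positive multiples of `Re
x₁` and `-Re e_r` (`nsv_of_response`). The task is thus to find `β` with `NΥ + β Nχ > 0` at every
frequency, and this is what the quadrant conditions provide (`IsTypeI.exists_multiplier`). A pole at
the origin is treated separately: absence of cancellation forces `x₂ = 0` and `-Re e_r = C_s(0)`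
there (`response_at_pole`). Type II is the mirror image of Type I.

Finally `Certificate.isGUAS` follows from exponential decay of `V`, and `Certificate.isUBIBS` from
the invariance of a sublevel set of `V + κ |x i₀|`: the second term shrinks at resets by enough to
pay for the linear gain of `V`. -/

open Matrix

/-! ### Strict dissipativity of covariance factors -/

section Dual

variable {n ι : Type*} [Fintype n] [Fintype ι] [DecidableEq ι]

/-- The complexification of a real matrix. -/
abbrev toC {m n : Type*} (M : Matrix m n ℝ) : Matrix m n ℂ := M.map (algebraMap ℝ ℂ)

lemma toC_mul {m n o : Type*} [Fintype n] (M : Matrix m n ℝ) (N : Matrix n o ℝ) :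
    toC (M * N) = toC M * toC N := by
  exact Matrix.map_mul

lemma toC_transpose {m n : Type*} (M : Matrix m n ℝ) : toC Mᵀ = (toC M)ᴴ := by
  ext i j; simp [toC, conjTranspose_apply]

/-- Multiplying the relation on the right by `X` gives `F D = -X Fᵀ X` with `D = diagonal d`
invertible, which defines `Ω`. Multiplying `F = X Ω` on the left by `Xᵀ` yields a second formula for
`Ω`, which is minus the transpose of the first. -/
lemma eq_mul_skew_of_orthogonal_columns {F X : Matrix n ι ℝ} {d : ι → ℝ}
    (hd : ∀ k, d k ≠ 0) (hX : Xᵀ * X = diagonal d) (h : F * Xᵀ + X * Fᵀ = 0) :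
    ∃ Ω : Matrix ι ι ℝ, F = X * Ω ∧ Ωᵀ = -Ω := by
  have hdd : diagonal d * diagonal (fun k => (d k)⁻¹) = 1 := by
    rw [diagonal_mul_diagonal, ← diagonal_one]
    congr 1; ext k; exact mul_inv_cancel₀ (hd k)
  have hdd' : diagonal (fun k => (d k)⁻¹) * diagonal d = 1 := by
    rw [diagonal_mul_diagonal, ← diagonal_one]
    congr 1; ext k; exact inv_mul_cancel₀ (hd k)
  set Ω : Matrix ι ι ℝ := -(Fᵀ * X * diagonal (fun k => (d k)⁻¹)) with hΩ
  have h1 : F * diagonal d = -(X * (Fᵀ * X)) := by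
    have := congrArg (· * X) h
    simp only [Matrix.add_mul, Matrix.zero_mul, Matrix.mul_assoc, hX] at this
    exact eq_neg_of_add_eq_zero_left this
  have h2 : F = X * Ω := by
    calc F = F * diagonal d * diagonal (fun k => (d k)⁻¹) := by
          rw [Matrix.mul_assoc, hdd, Matrix.mul_one]
      _ = X * Ω := by rw [h1, hΩ]; simp [Matrix.mul_assoc]
  refine ⟨Ω, h2, ?_⟩
  have h3 : Xᵀ * F = diagonal d * Ω := by
    rw [h2, ← Matrix.mul_assoc, hX]
  have h4 : Ω = diagonal (fun k => (d k)⁻¹) * (Xᵀ * F) := by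
    rw [h3, ← Matrix.mul_assoc, hdd', Matrix.one_mul]
  conv_rhs => rw [h4]
  rw [hΩ]
  simp [Matrix.transpose_mul]

/-- With `E A M = E M Ω` and `Ω` skew, unitary diagonalization of `Ω` turns the columns of `M` into
complex vectors satisfying the frequency equation with purely imaginary eigenvalues. The trace is
invariant under the unitary change of columns, so it is a sum of terms covered by `hfreq`. -/
lemma trace_neg_of_orthogonal_columns {A E B : Matrix n n ℝ} {M : Matrix n ι ℝ} {d : ι → ℝ}
    (hd : ∀ k, d k ≠ 0) (hX : (E * M)ᵀ * (E * M) = diagonal d)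
    (h : (E * A * M) * (E * M)ᵀ + (E * M) * (E * A * M)ᵀ = 0)
    (hfreq : ∀ (ω : ℝ) (z : n → ℂ), toC E *ᵥ (toC A *ᵥ z) = (Complex.I * ω) • (toC E *ᵥ z) →
      z ≠ 0 → (star z ⬝ᵥ (toC B *ᵥ z)).re < 0) (hM : M ≠ 0) :
    (Mᵀ * B * M).trace < 0 := by
  obtain ⟨Ω, hF, hΩ⟩ := eq_mul_skew_of_orthogonal_columns hd hX h
  have hH : (Complex.I • toC Ω).IsHermitian := by
    ext i j
    have : Ω j i = - Ω i j := congrFun (congrFun hΩ i) j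
    simp [conjTranspose_apply, this]
  set v : ι → ι → ℂ := fun k => (hH.eigenvectorBasis k).ofLp with hv
  have hvk : ∀ k, toC Ω *ᵥ v k = (Complex.I * ((-hH.eigenvalues k : ℝ) : ℂ)) • v k := by
    intro k
    have h1 := hH.mulVec_eigenvectorBasis k
    have h2 := congrArg (fun y => (-Complex.I) • y) h1
    simp only [Matrix.smul_mulVec, smul_smul] at h2
    rw [show -Complex.I * Complex.I = 1 by simp, one_smul] at h2
    rw [hv]; simp only
    rw [h2]
    ext i
    simp [mul_assoc]
  set z : ι → n → ℂ := fun k => toC M *ᵥ v k with hz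
  have hzk : ∀ k, toC E *ᵥ (toC A *ᵥ z k) =
      (Complex.I * ((-hH.eigenvalues k : ℝ) : ℂ)) • (toC E *ᵥ z k) := by
    intro k
    have hF' : toC E * toC A * toC M = toC E * toC M * toC Ω := by
      rw [← toC_mul, ← toC_mul, ← toC_mul, ← toC_mul, hF]
    simp only [hz, Matrix.mulVec_mulVec]
    rw [← Matrix.mul_assoc, hF', ← Matrix.mulVec_mulVec, hvk, Matrix.mulVec_smul]
  set U : Matrix ι ι ℂ := (hH.eigenvectorUnitary : Matrix ι ι ℂ) with hU
  have hUU : U * star U = 1 := (Matrix.mem_unitaryGroup_iff).1 hH.eigenvectorUnitary.2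
  have hsum : ((Mᵀ * B * M).trace : ℂ) = ∑ k, star (z k) ⬝ᵥ (toC B *ᵥ z k) := by
    have h1 : ((Mᵀ * B * M).trace : ℂ) = (toC (Mᵀ * B * M)).trace := by
      simp only [Matrix.trace, diag_apply, Complex.ofReal_sum]
      rfl
    have h2 : (toC (Mᵀ * B * M)).trace = (star U * (toC (Mᵀ * B * M)) * U).trace := by
      rw [Matrix.trace_mul_cycle, hUU, Matrix.one_mul]
    rw [h1, h2, toC_mul, toC_mul, toC_transpose, Matrix.trace]
    refine Finset.sum_congr rfl fun k _ => ?_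
    have hcol : ∀ i, (toC M * U) i k = z k i := by
      intro i
      simp [hz, hv, hU, Matrix.mul_apply, Matrix.mulVec, dotProduct]
    have : star U * ((toC M)ᴴ * toC B * toC M) * U = (toC M * U)ᴴ * (toC B * (toC M * U)) := by
      rw [Matrix.conjTranspose_mul, Matrix.star_eq_conjTranspose]
      simp only [Matrix.mul_assoc]
    rw [this, diag_apply, Matrix.mul_apply]
    simp only [dotProduct, conjTranspose_apply, hcol, Pi.star_apply]
    refine Finset.sum_congr rfl fun i _ => ?_
    rw [Matrix.mul_apply]
    simp [Matrix.mulVec, dotProduct, hcol]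
  have hre : (Mᵀ * B * M).trace = ∑ k, (star (z k) ⬝ᵥ (toC B *ᵥ z k)).re := by
    have := congrArg Complex.re hsum
    simpa using this
  have hle : ∀ k, (star (z k) ⬝ᵥ (toC B *ᵥ z k)).re ≤ 0 := by
    intro k
    by_cases hk : z k = 0
    · simp [hk]
    · exact (hfreq _ _ (hzk k) hk).le
  rw [hre]
  by_contra hcon
  have hzero : ∑ k, (star (z k) ⬝ᵥ (toC B *ᵥ z k)).re = 0 :=
    le_antisymm (Finset.sum_nonpos fun k _ => hle k) (not_lt.1 hcon)
  have hall : ∀ k, z k = 0 := by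
    intro k
    by_contra hk
    have := (Finset.sum_eq_zero_iff_of_nonpos (fun k _ => hle k)).1 hzero k (Finset.mem_univ k)
    exact (hfreq _ _ (hzk k) hk).ne this
  have hMU : toC M * U = 0 := by
    ext i k
    have := congrFun (hall k) i
    simpa [hz, hv, hU, Matrix.mul_apply, Matrix.mulVec, dotProduct] using this
  have hM0 : toC M = 0 := by
    calc toC M = toC M * (U * star U) := by rw [hUU, Matrix.mul_one]
      _ = 0 := by rw [← Matrix.mul_assoc, hMU, Matrix.zero_mul]
  apply hM
  ext i k
  have := congrFun (congrFun hM0 i) k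
  simpa using this

/-- An orthogonal change of columns makes the columns of `E * M` orthogonal. The columns annihilated
by `E` fall under `hinf`, which plays the role of infinite frequency; the remaining ones fall under
the previous lemma. -/
lemma trace_neg_of_skew {A E B : Matrix n n ℝ} {M : Matrix n ι ℝ}
    (h : (E * A * M) * (E * M)ᵀ + (E * M) * (E * A * M)ᵀ = 0)
    (hinf : ∀ m : n → ℝ, E *ᵥ m = 0 → m ≠ 0 → m ⬝ᵥ (B *ᵥ m) < 0)
    (hfreq : ∀ (ω : ℝ) (z : n → ℂ), toC E *ᵥ (toC A *ᵥ z) = (Complex.I * ω) • (toC E *ᵥ z) →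
      z ≠ 0 → (star z ⬝ᵥ (toC B *ᵥ z)).re < 0) (hM : M ≠ 0) :
    (Mᵀ * B * M).trace < 0 := by
  have hS : ((E * M)ᵀ * (E * M)).IsHermitian := by
    rw [← conjTranspose_eq_transpose_of_trivial]
    exact Matrix.isHermitian_conjTranspose_mul_self _
  set Q : Matrix ι ι ℝ := (hS.eigenvectorUnitary : Matrix ι ι ℝ) with hQ
  set d := hS.eigenvalues with hd
  have hQQ : Q * Qᵀ = 1 := by
    have := (Matrix.mem_unitaryGroup_iff).1 hS.eigenvectorUnitary.2
    rwa [Matrix.star_eq_conjTranspose, conjTranspose_eq_transpose_of_trivial] at this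
  have hQQ' : Qᵀ * Q = 1 := mul_eq_one_comm.1 hQQ
  have hdiag : (E * (M * Q))ᵀ * (E * (M * Q)) = diagonal d := by
    have hspec := hS.spectral_theorem
    rw [Unitary.conjStarAlgAut_apply, Matrix.star_eq_conjTranspose,
      conjTranspose_eq_transpose_of_trivial] at hspec
    have e : (E * (M * Q))ᵀ * (E * (M * Q)) = Qᵀ * ((E * M)ᵀ * (E * M)) * Q := by
      simp only [Matrix.transpose_mul, Matrix.mul_assoc]
    rw [e, hspec]
    change Qᵀ * (Q * diagonal d * Qᵀ) * Q = diagonal d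
    rw [← Matrix.mul_assoc, ← Matrix.mul_assoc, hQQ', Matrix.one_mul, Matrix.mul_assoc, hQQ',
      Matrix.mul_one]
  set N := M * Q with hN
  have hMN : M = N * Qᵀ := by rw [hN, Matrix.mul_assoc, hQQ, Matrix.mul_one]
  have hN0 : N ≠ 0 := by
    intro h0; apply hM; rw [hMN, h0, Matrix.zero_mul]
  have htr : (Mᵀ * B * M).trace = ∑ k, N.col k ⬝ᵥ (B *ᵥ N.col k) := by
    have : (Mᵀ * B * M).trace = (Nᵀ * B * N).trace := by
      have e : Nᵀ * B * N = Qᵀ * (Mᵀ * B * M) * Q := by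
        rw [hN]; simp only [Matrix.transpose_mul, Matrix.mul_assoc]
      rw [e, Matrix.trace_mul_cycle Qᵀ, hQQ, Matrix.one_mul]
    rw [this, Matrix.trace]
    refine Finset.sum_congr rfl fun k _ => ?_
    rw [diag_apply, Matrix.mul_assoc, Matrix.mul_apply]
    simp [dotProduct, Matrix.mul_apply, Matrix.mulVec]
  have hskew : (E * A * N) * (E * N)ᵀ + (E * N) * (E * A * N)ᵀ = 0 := by
    have e1 : (E * A * N) * (E * N)ᵀ = (E * A * M) * (E * M)ᵀ := by
      rw [hN]; simp only [Matrix.transpose_mul, Matrix.mul_assoc]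
      rw [← Matrix.mul_assoc Q, hQQ, Matrix.one_mul]
    have e2 : (E * N) * (E * A * N)ᵀ = (E * M) * (E * A * M)ᵀ := by
      rw [hN]; simp only [Matrix.transpose_mul, Matrix.mul_assoc]
      rw [← Matrix.mul_assoc Q, hQQ, Matrix.one_mul]
    rw [e1, e2, h]
  have hcol0 : ∀ k, d k = 0 → ∀ i, (E * N) i k = 0 := by
    intro k hk
    have := congrFun (congrFun hdiag k) k
    rw [diagonal_apply_eq, hk, Matrix.mul_apply] at this
    simp only [transpose_apply] at this
    intro i
    have := (Finset.sum_eq_zero_iff_of_nonneg (fun i _ => mul_self_nonneg _)).1 this i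
      (Finset.mem_univ i)
    exact mul_self_eq_zero.1 this
  set N₁ : Matrix n {k // d k ≠ 0} ℝ := N.submatrix id Subtype.val with hN₁
  have hEN₁ : ∀ C : Matrix n n ℝ, C * N₁ = (C * N).submatrix id Subtype.val := by
    intro C; ext i k; simp [hN₁, Matrix.mul_apply]
  have hdiag₁ : (E * N₁)ᵀ * (E * N₁) = diagonal fun k : {k // d k ≠ 0} => d k := by
    ext k l
    have := congrFun (congrFun hdiag k) l
    rw [hEN₁]
    rw [Matrix.mul_apply] at this ⊢
    simp only [transpose_apply, submatrix_apply, id] at this ⊢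
    rw [this]
    simp [diagonal_apply, Subtype.ext_iff]
  have hsub : ∀ f : ι → ℝ, (∀ k, d k = 0 → f k = 0) →
      ∑ k : {k // d k ≠ 0}, f k = ∑ k, f k := by
    intro f hf
    rw [← Fintype.sum_subtype_add_sum_subtype (fun k => d k ≠ 0) f]
    rw [left_eq_add]
    exact Finset.sum_eq_zero fun k _ => hf _ (not_not.1 k.2)
  -- Every product contains a column of `E * N`, so discarding the columns where it vanishes does
  -- not change the relation.
  have hskew₁ : (E * A * N₁) * (E * N₁)ᵀ + (E * N₁) * (E * A * N₁)ᵀ = 0 := by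
    rw [← hskew, hEN₁, hEN₁]
    ext i j
    simp only [Matrix.add_apply, Matrix.mul_apply (M := Matrix.submatrix _ _ _),
      Matrix.mul_apply (M := E * A * N), Matrix.mul_apply (M := E * N), transpose_apply,
      submatrix_apply, id]
    rw [hsub (fun k => (E * A * N) i k * (E * N) j k) (fun k hk => by simp [hcol0 k hk]),
      hsub (fun k => (E * N) i k * (E * A * N) j k) (fun k hk => by simp [hcol0 k hk])]
  have htr₁ : ∑ k : {k // d k ≠ 0}, N.col k ⬝ᵥ (B *ᵥ N.col k) = (N₁ᵀ * B * N₁).trace := by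
    rw [Matrix.trace]
    refine Finset.sum_congr rfl fun k _ => ?_
    rw [diag_apply, Matrix.mul_assoc, Matrix.mul_apply]
    simp [dotProduct, Matrix.mul_apply, Matrix.mulVec, hN₁]
  have hcolE : ∀ k, d k = 0 → E *ᵥ N.col k = 0 := by
    intro k hk
    ext i
    simpa [Matrix.mul_apply, Matrix.mulVec, dotProduct] using hcol0 k hk i
  have hle₂ : ∀ k : {k // ¬ d k ≠ 0}, N.col k ⬝ᵥ (B *ᵥ N.col k) ≤ 0 := by
    intro k
    by_cases h0 : N.col k = 0
    · simp [h0]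
    · exact (hinf _ (hcolE k (not_not.1 k.2)) h0).le
  rw [htr, ← Fintype.sum_subtype_add_sum_subtype (fun k => d k ≠ 0), htr₁]
  by_cases hz : N₁ = 0
  · rw [hz]
    simp only [transpose_zero, Matrix.zero_mul, trace_zero, zero_add]
    by_contra hcon
    have hzero := le_antisymm (Finset.sum_nonpos fun k _ => hle₂ k) (not_lt.1 hcon)
    apply hN0
    ext i k
    by_cases hk : d k = 0
    · have := (Finset.sum_eq_zero_iff_of_nonpos (fun k _ => hle₂ k)).1 hzero
        ⟨k, not_not.2 hk⟩ (Finset.mem_univ _)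
      by_contra h0
      refine (hinf _ (hcolE k hk) ?_).ne this
      intro h1
      exact h0 (congrFun h1 i)
    · exact congrFun (congrFun hz i) ⟨k, hk⟩
  · have := trace_neg_of_orthogonal_columns (fun k : {k // d k ≠ 0} => k.2) hdiag₁ hskew₁ hfreq hz
    have h2 := Finset.sum_nonpos (s := Finset.univ) (fun k _ => hle₂ k)
    linarith

end Dual

/-! ### The strict positive real lemma by convex duality. -/

section KYP

variable {n : Type*} [Fintype n]

/-- Boundedness: diagonal entries are at most the trace, and off-diagonal entries are bounded by the
mean of two diagonal ones. -/
lemma isCompact_posSemidef_trace_one :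
    IsCompact {Z : Matrix n n ℝ | Z.PosSemidef ∧ Z.trace = 1} := by
  have hK : IsCompact (Set.pi Set.univ fun _ : n => Set.pi Set.univ fun _ : n =>
      Set.Icc (-1 : ℝ) 1) :=
    isCompact_univ_pi fun _ => isCompact_univ_pi fun _ => isCompact_Icc
  refine IsCompact.of_isClosed_subset hK ?_ ?_
  · have : {Z : Matrix n n ℝ | Z.PosSemidef ∧ Z.trace = 1} =
        {Z : Matrix n n ℝ | Zᴴ = Z} ∩ (⋂ x : n → ℝ, {Z | 0 ≤ star x ⬝ᵥ (Z *ᵥ x)}) ∩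
          {Z | Z.trace = 1} := by
      ext Z
      simp [posSemidef_iff_dotProduct_mulVec, Matrix.IsHermitian]
    rw [this]
    refine ((isClosed_eq (by fun_prop) (by fun_prop)).inter
      (isClosed_iInter fun x => isClosed_le (by fun_prop) (by fun_prop))).inter
      (isClosed_eq (by fun_prop) (by fun_prop))
  · rintro Z ⟨hZ, htr⟩
    obtain ⟨m, v, rfl⟩ := posSemidef_iff_eq_sum_vecMulVec.1 hZ
    have hent : ∀ i j, (∑ k, vecMulVec (v k) (star (v k))) i j = ∑ k, v k i * v k j := by
      intro i j
      simp [Matrix.sum_apply, vecMulVec_apply]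
    have hdiag : ∀ i, ∑ k, v k i * v k i ≤ 1 := by
      intro i
      rw [← htr, Matrix.trace]
      simp only [diag_apply, hent]
      exact Finset.single_le_sum (f := fun i => ∑ k, v k i * v k i)
        (fun i _ => Finset.sum_nonneg fun k _ => mul_self_nonneg _) (Finset.mem_univ i)
    intro i _ j _
    change (∑ k, vecMulVec (v k) (star (v k))) i j ∈ _
    rw [hent]
    have h1 : ∑ k, v k i * v k j ≤ ∑ k, (v k i * v k i + v k j * v k j) / 2 :=
      Finset.sum_le_sum fun k _ => by nlinarith [sq_nonneg (v k i - v k j)]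
    have h2 : ∑ k, -((v k i * v k i + v k j * v k j) / 2) ≤ ∑ k, v k i * v k j :=
      Finset.sum_le_sum fun k _ => by nlinarith [sq_nonneg (v k i + v k j)]
    rw [Finset.sum_neg_distrib] at h2
    rw [← Finset.sum_div, Finset.sum_add_distrib] at h1 h2
    have := hdiag i
    have := hdiag j
    constructor <;> linarith

lemma dotProduct_mulVec_symm {P : Matrix n n ℝ} (hP : Pᵀ = P) (x y : n → ℝ) :
    x ⬝ᵥ (P *ᵥ y) = (P *ᵥ x) ⬝ᵥ y := by
  rw [Matrix.dotProduct_mulVec, ← Matrix.mulVec_transpose, hP]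

/-- Theorem of alternatives for a strict Lyapunov inequality on an affine space of matrices. -/
lemma exists_lyapunov_correction [DecidableEq n] {A E P₀ : Matrix n n ℝ} {b : n → ℝ} (hE : Eᵀ = E) (hb : b ≠ 0)
    (hEb : E *ᵥ b = 0)
    (hinf : ∀ m : n → ℝ, E *ᵥ m = 0 → m ≠ 0 → m ⬝ᵥ ((P₀ * A) *ᵥ m) < 0)
    (hfreq : ∀ (ω : ℝ) (z : n → ℂ), toC E *ᵥ (toC A *ᵥ z) = (Complex.I * ω) • (toC E *ᵥ z) →
      z ≠ 0 → (star z ⬝ᵥ (toC (P₀ * A) *ᵥ z)).re < 0) :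
    ∃ P₁ : Matrix n n ℝ, P₁ᵀ = P₁ ∧ P₁ *ᵥ b = 0 ∧
      ∀ x : n → ℝ, x ≠ 0 → x ⬝ᵥ ((P₀ + P₁) *ᵥ (A *ᵥ x)) < 0 := by
  -- The second component is the contribution of `P₀` to the Lyapunov inequality tested against a
  -- covariance `Z`. The first is dual to corrections of the form `E * Γ * E`, which annihilate `b`.
  let π : Matrix n n ℝ →ₗ[ℝ] (n → n → ℝ) × ℝ :=
    { toFun := fun Z => (fun i j => (E * A * Z * E + E * Z * Aᵀ * E) i j, (P₀ * A * Z).trace)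
      map_add' := by
        intro Y Z
        ext
        · simp [Matrix.mul_add, Matrix.add_mul]; ring
        · simp [Matrix.mul_add]
      map_smul' := by
        intro r Z
        ext
        · simp; ring
        · simp }
  have hπ : Continuous π := by
    change Continuous fun Z : Matrix n n ℝ => ((fun i j => (E * A * Z * E + E * Z * Aᵀ * E) i j,
      (P₀ * A * Z).trace) : (n → n → ℝ) × ℝ)
    refine Continuous.prodMk ?_ (by fun_prop)
    change Continuous fun Z : Matrix n n ℝ => E * A * Z * E + E * Z * Aᵀ * E
    fun_prop
  set K : Set (Matrix n n ℝ) := {Z : Matrix n n ℝ | Z.PosSemidef ∧ Z.trace = 1} with hK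
  have hKconv : Convex ℝ K := by
    rintro Y ⟨hY, hY1⟩ Z ⟨hZ, hZ1⟩ a c ha hc hac
    exact ⟨(hY.smul ha).add (hZ.smul hc), by simp [hY1, hZ1, hac]⟩
  -- A common point would be a covariance `Z = V Vᵀ` whose factor satisfies the skew relation
  -- although the trace of `P₀ A Z` is nonnegative, against `trace_neg_of_skew`.
  have hdisj : Disjoint (π '' K) ({0} ×ˢ Set.Ici (0 : ℝ)) := by
    rw [Set.disjoint_left]
    rintro _ ⟨Z, ⟨hZ, htr⟩, rfl⟩ ⟨h1, h2⟩
    obtain ⟨m, v, hv⟩ := posSemidef_iff_eq_sum_vecMulVec.1 hZ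
    set V : Matrix n (Fin m) ℝ := Matrix.of fun i k => v k i with hV
    have hZV : Z = V * Vᵀ := by
      ext i j
      rw [hv]
      simp [hV, Matrix.mul_apply, Matrix.sum_apply, vecMulVec_apply]
    have hV0 : V ≠ 0 := by
      intro h0
      rw [hZV, h0] at htr
      simp at htr
    have hskew : (E * A * V) * (E * V)ᵀ + (E * V) * (E * A * V)ᵀ = 0 := by
      have : E * A * Z * E + E * Z * Aᵀ * E = 0 := by
        ext i j
        exact congrFun (congrFun h1 i) j
      rw [← this, hZV]
      simp only [Matrix.transpose_mul, hE, Matrix.mul_assoc]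
    have hlt := trace_neg_of_skew hskew hinf hfreq hV0
    have h2' : 0 ≤ (P₀ * A * Z).trace := h2
    rw [hZV, ← Matrix.mul_assoc, Matrix.trace_mul_comm, ← Matrix.mul_assoc] at h2'
    linarith
  obtain ⟨f, u, v, hfu, huv, hvf⟩ := geometric_hahn_banach_compact_closed
    (hKconv.linear_image π) (isCompact_posSemidef_trace_one.image hπ)
    ((convex_singleton 0).prod (convex_Ici 0)) (isClosed_singleton.prod isClosed_Ici) hdisj
  have hv0 : v < 0 := by
    have := hvf (0, 0) (by simp)
    rwa [Prod.mk_zero_zero, map_zero] at this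
  set τ : ℝ := f (0, 1) with hτ
  have hft : ∀ t : ℝ, f (0, t) = t * τ := by
    intro t
    rw [hτ, ← smul_eq_mul, ← map_smul]
    simp
  have hτ0 : 0 ≤ τ := by
    by_contra hneg
    have h1 := hvf (0, v / τ) (by
      simp only [Set.mem_prod, Set.mem_singleton_iff, Set.mem_Ici, true_and]
      exact div_nonneg_of_nonpos hv0.le (not_le.1 hneg).le)
    rw [hft, div_mul_cancel₀ _ (by intro h; exact hneg h.ge)] at h1
    exact lt_irrefl _ h1
  -- The separating functional is the pair of a matrix `Γ` and the number `τ`; `P₁` is the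
  -- symmetrized, compressed `Γ`, and testing on `x xᵀ` gives `hneg`.
  set Γ : Matrix n n ℝ := Matrix.of fun i j => f (Pi.single i (Pi.single j 1), 0) with hΓ
  have hfY : ∀ Y : n → n → ℝ, f (Y, 0) = ∑ i, ∑ j, Y i j * Γ i j := by
    intro Y
    have hY : (Y, (0 : ℝ)) = ∑ i, ∑ j, Y i j •
        ((Pi.single i (Pi.single j 1), 0) : (n → n → ℝ) × ℝ) := by
      ext i j
      · simp only [Prod.fst_sum, Prod.smul_fst, Finset.sum_apply, Pi.smul_apply, smul_eq_mul]
        rw [Finset.sum_eq_single i, Finset.sum_eq_single j]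
        · simp
        · intro k _ hk; simp [hk.symm]
        · simp
        · intro k _ hk; simp [hk.symm]
        · simp
      · simp [Prod.snd_sum]
    rw [hY]
    simp only [map_sum, map_smul, smul_eq_mul, hΓ, of_apply]
  have hf : ∀ Y t, f (Y, t) = (∑ i, ∑ j, Y i j * Γ i j) + t * τ := by
    intro Y t
    rw [← hfY, ← hft, ← map_add]
    simp
  set P₁ : Matrix n n ℝ := E * (Γ + Γᵀ) * E with hP₁
  have hP₁s : P₁ᵀ = P₁ := by
    rw [hP₁]; simp only [Matrix.transpose_mul, hE, Matrix.transpose_add, transpose_transpose,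
      Matrix.mul_assoc, add_comm]
  have hP₁b : P₁ *ᵥ b = 0 := by
    rw [hP₁, ← Matrix.mulVec_mulVec, hEb, Matrix.mulVec_zero]
  have hneg : ∀ x : n → ℝ, x ≠ 0 →
      x ⬝ᵥ (P₁ *ᵥ (A *ᵥ x)) + τ * (x ⬝ᵥ (P₀ *ᵥ (A *ᵥ x))) < 0 := by
    intro x hx
    have hxx : 0 < x ⬝ᵥ x := by
      have : 0 ≤ x ⬝ᵥ x := Finset.sum_nonneg fun i _ => mul_self_nonneg _
      exact lt_of_le_of_ne this (fun h => hx (dotProduct_self_eq_zero.1 h.symm))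
    set Z : Matrix n n ℝ := vecMulVec x x with hZ
    have hmem : (x ⬝ᵥ x)⁻¹ • Z ∈ K := by
      refine ⟨PosSemidef.smul ?_ (inv_nonneg.2 hxx.le), ?_⟩
      · simpa using posSemidef_vecMulVec_self_star x
      · rw [Matrix.trace_smul, hZ, Matrix.trace_vecMulVec, smul_eq_mul, inv_mul_cancel₀ hxx.ne']
    have h1 := hfu _ ⟨_, hmem, rfl⟩
    rw [map_smul, map_smul, smul_eq_mul] at h1
    have h2 : f (π Z) < 0 := by
      have : (x ⬝ᵥ x)⁻¹ * f (π Z) < 0 := by linarith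
      by_contra hcon
      have := mul_nonneg (inv_nonneg.2 hxx.le) (not_lt.1 hcon)
      linarith
    have h3 : f (π Z) = (∑ i, ∑ j, (E * A * Z * E + E * Z * Aᵀ * E) i j * Γ i j) +
        (P₀ * A * Z).trace * τ := hf _ _
    have h4 : (P₀ * A * Z).trace = x ⬝ᵥ (P₀ *ᵥ (A *ᵥ x)) := by
      rw [hZ, Matrix.mul_vecMulVec, Matrix.trace_vecMulVec, Matrix.mulVec_mulVec, dotProduct_comm]
    have hEA : E * A * Z * E = vecMulVec (E *ᵥ (A *ᵥ x)) (E *ᵥ x) := by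
      rw [hZ, Matrix.mul_vecMulVec, Matrix.vecMulVec_mul, ← Matrix.mulVec_transpose, hE,
        Matrix.mulVec_mulVec]
    have hEA' : E * Z * Aᵀ * E = vecMulVec (E *ᵥ x) (E *ᵥ (A *ᵥ x)) := by
      rw [hZ, Matrix.mul_vecMulVec, Matrix.vecMulVec_mul, Matrix.vecMulVec_mul,
        ← Matrix.mulVec_transpose, ← Matrix.mulVec_transpose, hE, transpose_transpose]
    have h5 : x ⬝ᵥ (P₁ *ᵥ (A *ᵥ x)) =
        ∑ i, ∑ j, (E * A * Z * E + E * Z * Aᵀ * E) i j * Γ i j := by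
      rw [hEA, hEA', hP₁, ← Matrix.mulVec_mulVec, ← Matrix.mulVec_mulVec,
        dotProduct_mulVec_symm hE, Matrix.add_mulVec, dotProduct_add]
      generalize E *ᵥ (A *ᵥ x) = q
      generalize E *ᵥ x = p
      simp only [Matrix.add_apply, vecMulVec_apply, add_mul, Finset.sum_add_distrib]
      rw [add_comm]
      congr 1
      · rw [Finset.sum_comm]
        simp only [dotProduct, Matrix.mulVec, transpose_apply, Finset.mul_sum]
        refine Finset.sum_congr rfl fun i _ => Finset.sum_congr rfl fun j _ => by ring
      · simp only [dotProduct, Matrix.mulVec, Finset.mul_sum]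
        refine Finset.sum_congr rfl fun i _ => Finset.sum_congr rfl fun j _ => by ring
    rw [h5, ← h4, mul_comm τ, ← h3]
    exact h2
  -- At `x = b` the correction contributes nothing because `P₁ b = 0`, so `τ = 0` would give `0 <
  -- 0`.
  have hτpos : 0 < τ := by
    refine lt_of_le_of_ne hτ0 fun h => ?_
    have := hneg b hb
    rw [dotProduct_mulVec_symm hP₁s, hP₁b, ← h] at this
    simp at this
  refine ⟨τ⁻¹ • P₁, by rw [Matrix.transpose_smul, hP₁s], by
    rw [Matrix.smul_mulVec, hP₁b, smul_zero], fun x hx => ?_⟩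
  have h1 := hneg x hx
  rw [Matrix.add_mulVec, dotProduct_add, Matrix.smul_mulVec, dotProduct_smul, smul_eq_mul]
  have h2 : x ⬝ᵥ (P₀ *ᵥ (A *ᵥ x)) + τ⁻¹ * (x ⬝ᵥ (P₁ *ᵥ (A *ᵥ x))) =
      τ⁻¹ * (x ⬝ᵥ (P₁ *ᵥ (A *ᵥ x)) + τ * (x ⬝ᵥ (P₀ *ᵥ (A *ᵥ x)))) := by
    field_simp; ring
  rw [h2]
  exact mul_neg_of_pos_of_neg (inv_pos.2 hτpos) h1

/-- The strict positive real lemma for an input vector that is a unit coordinate vector. No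
controllability or observability is assumed. -/
theorem exists_lyapunov_of_strictly_positive_real [DecidableEq n] {A : Matrix n n ℝ} {i₀ : n} {c : n → ℝ}
    (hinf : c ⬝ᵥ (A *ᵥ Pi.single i₀ 1) < 0)
    (hfreq : ∀ (ω : ℝ) (z : n → ℂ) (μ : ℂ),
      (Complex.I * ω) • z = toC A *ᵥ z + Pi.single i₀ μ → z ≠ 0 →
      0 < (star μ * ∑ i, (c i : ℂ) * z i).re) :
    ∃ P : Matrix n n ℝ, Pᵀ = P ∧ P *ᵥ Pi.single i₀ 1 = c ∧
      ∀ x : n → ℝ, x ≠ 0 → x ⬝ᵥ (P *ᵥ (A *ᵥ x)) < 0 := by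
  set b : n → ℝ := Pi.single i₀ 1 with hb
  -- `E` projects away the coordinate `i₀`, and `P₀` is a simple symmetric solution of `P₀ b = c`;
  -- only a correction killing `b` remains to be found.
  set E : Matrix n n ℝ := diagonal (fun i => if i = i₀ then 0 else 1) with hE
  set P₀ : Matrix n n ℝ := Matrix.of fun i j => if j = i₀ then c i else if i = i₀ then c j else 0
    with hP₀
  have hEs : Eᵀ = E := by rw [hE, diagonal_transpose]
  have hP₀s : P₀ᵀ = P₀ := by
    ext i j
    simp only [hP₀, transpose_apply, of_apply]
    split_ifs <;> simp_all
  have hP₀b : P₀ *ᵥ b = c := by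
    ext i
    simp [hb, hP₀]
  have hb0 : b ≠ 0 := by
    intro h
    have := congrFun h i₀
    simp [hb] at this
  have hEb : E *ᵥ b = 0 := by
    ext i
    by_cases hi : i = i₀ <;> simp [hb, hE, mulVec_diagonal, hi]
  refine Exists.elim (exists_lyapunov_correction (A := A) (P₀ := P₀) hEs hb0 hEb ?_ ?_) ?_
  · intro m hm hm0
    have hmb : m = m i₀ • b := by
      ext i
      by_cases hi : i = i₀
      · subst hi; simp [hb]
      · have := congrFun hm i
        simpa [hE, mulVec_diagonal, hi, hb] using this
    have hmi : m i₀ ≠ 0 := by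
      intro h; rw [h, zero_smul] at hmb; exact hm0 hmb
    have : m ⬝ᵥ ((P₀ * A) *ᵥ m) = m i₀ ^ 2 * (c ⬝ᵥ (A *ᵥ b)) := by
      rw [← Matrix.mulVec_mulVec, dotProduct_mulVec_symm hP₀s]
      conv_lhs => rw [hmb]
      rw [Matrix.mulVec_smul, hP₀b, Matrix.mulVec_smul, smul_dotProduct, dotProduct_smul]
      simp only [smul_eq_mul]; ring
    rw [this]
    exact mul_neg_of_pos_of_neg (by positivity) hinf
  · intro ω z hz hz0
    set μ : ℂ := (Complex.I * ω) * z i₀ - (toC A *ᵥ z) i₀ with hμ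
    have hz1 : (Complex.I * ω) • z = toC A *ᵥ z + Pi.single i₀ μ := by
      ext i
      by_cases hi : i = i₀
      · subst hi; simp [hμ]
      · have := congrFun hz i
        simp only [toC, hE, diagonal_map, map_zero, mulVec_diagonal, Pi.smul_apply, hi,
          if_false, map_one, one_mul, smul_eq_mul] at this
        rw [Pi.add_apply, Pi.single_eq_of_ne hi, add_zero, Pi.smul_apply, smul_eq_mul]
        exact this.symm
    have hpos := hfreq ω z μ hz1 hz0
    have hAz : toC A *ᵥ z = (Complex.I * ω) • z - Pi.single i₀ μ := by
      rw [hz1]; simp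
    have hPs : toC P₀ *ᵥ Pi.single i₀ μ = fun i => (c i : ℂ) * μ := by
      ext i
      simp [toC, hP₀]
    have hreal : (star z ⬝ᵥ (toC P₀ *ᵥ z)).im = 0 := by
      rw [← Complex.conj_eq_iff_im]
      have : (starRingEnd ℂ) (star z ⬝ᵥ (toC P₀ *ᵥ z)) = star (star z ⬝ᵥ (toC P₀ *ᵥ z)) := rfl
      rw [this, ← Matrix.star_dotProduct, Matrix.star_mulVec, ← toC_transpose, hP₀s,
        Matrix.dotProduct_mulVec]
    -- Since `A z = jω z - μ b`, the first part contributes `jω` times a real number and only `-μ c`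
    -- survives in the real part.
    rw [toC_mul, ← Matrix.mulVec_mulVec, hAz, Matrix.mulVec_sub, Matrix.mulVec_smul, hPs,
      dotProduct_sub, dotProduct_smul]
    have e1 : ((Complex.I * (ω : ℂ)) • (star z ⬝ᵥ (toC P₀ *ᵥ z))).re = 0 := by
      simp [hreal]
    have e2 : (star z ⬝ᵥ fun i => (c i : ℂ) * μ) = star (star μ * ∑ i, (c i : ℂ) * z i) := by
      simp only [star_mul', star_star, dotProduct, Pi.star_apply, star_sum, Finset.mul_sum]
      refine Finset.sum_congr rfl fun i _ => ?_
      have : star ((c i : ℂ)) = c i := Complex.conj_ofReal _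
      rw [this]; ring
    have e3 : ∀ w : ℂ, (star w).re = w.re := Complex.conj_re
    rw [Complex.sub_re, e1, e2, e3]
    linarith
  · rintro P₁ ⟨hs, h1, h2⟩
    refine ⟨P₀ + P₁, by rw [Matrix.transpose_add, hP₀s, hs], ?_, h2⟩
    rw [Matrix.add_mulVec, hP₀b, h1, add_zero]

end KYP

/-! ### Positivity of Lyapunov solutions for Hurwitz matrices. -/

section Lyapunov

variable {n : Type*} [Fintype n] [DecidableEq n]

lemma IsHurwitz.det_ne_zero {A : Matrix n n ℝ} (hA : IsHurwitz A) {s : ℂ} (hs : 0 ≤ s.re) :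
    (Matrix.scalar n s - toC A).det ≠ 0 := by
  intro h
  have : (A.charpoly.map (algebraMap ℝ ℂ)).IsRoot s := by
    rw [← Matrix.charpoly_map, IsRoot, Matrix.eval_charpoly]
    exact h
  exact absurd (hA s this) (not_lt.2 hs)

lemma IsHurwitz.eq_zero_of_eigenvector {A : Matrix n n ℝ} (hA : IsHurwitz A) {s : ℂ}
    (hs : 0 ≤ s.re) {z : n → ℂ} (hz : toC A *ᵥ z = s • z) : z = 0 := by
  by_contra h0
  refine hA.det_ne_zero hs (Matrix.exists_mulVec_eq_zero_iff.1 ⟨z, h0, ?_⟩)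
  rw [Matrix.sub_mulVec, hz, Matrix.scalar_apply, ← Matrix.smul_one_eq_diagonal,
    Matrix.smul_mulVec, Matrix.one_mulVec, sub_self]

open scoped Matrix.Norms.Operator in
-- Gelfand's formula: the spectral radius is below some `r < 1`, so eventually `‖a ^ k‖ < r ^ k`.
lemma tendsto_pow_of_spectrum {a : Matrix n n ℂ} (ha : ∀ z ∈ spectrum ℂ a, ‖z‖ < 1) :
    Tendsto (fun k => ‖a ^ k‖) atTop (𝓝 0) := by
  rcases isEmpty_or_nonempty n with hn | hn
  · have : ∀ k, a ^ k = 0 := fun k => Subsingleton.elim _ _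
    simp [this]
  · have hlt : spectralRadius ℂ a < ((1 : NNReal) : ENNReal) :=
      spectrum.spectralRadius_lt_of_forall_lt a fun z hz => by
        rw [← NNReal.coe_lt_coe]; simpa using ha z hz
    obtain ⟨r, hr1, hr2⟩ := ENNReal.lt_iff_exists_nnreal_btwn.1 hlt
    have hr : r < 1 := by exact_mod_cast hr2
    have hev := (spectrum.pow_nnnorm_pow_one_div_tendsto_nhds_spectralRadius a).eventually_lt_const hr1
    refine squeeze_zero' (Eventually.of_forall fun k => norm_nonneg _) ?_
      (tendsto_pow_atTop_nhds_zero_of_lt_one r.2 (by exact_mod_cast hr))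
    filter_upwards [hev, eventually_gt_atTop 0] with k hk hk0
    have hk0' : (0 : ℝ) < k := by exact_mod_cast hk0
    have h1 : ((‖a ^ k‖₊ : ENNReal)) < (r : ENNReal) ^ (k : ℝ) := by
      have := ENNReal.rpow_lt_rpow hk hk0'
      rwa [← ENNReal.rpow_mul, one_div, inv_mul_cancel₀ hk0'.ne', ENNReal.rpow_one] at this
    rw [ENNReal.rpow_natCast] at h1
    have h2 : ‖a ^ k‖₊ < r ^ k := by exact_mod_cast h1
    exact le_of_lt (by exact_mod_cast h2)

/-- If `v` is an eigenvector of the Cayley transform for `z`, then `(1 - A)⁻¹ v` is one of `A` for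
`(z - 1) / (z + 1)`, and this number lies in the left half-plane exactly when `|z| < 1`. -/
lemma IsHurwitz.cayley_spectrum {A : Matrix n n ℝ} (hA : IsHurwitz A) {a : Matrix n n ℂ}
    (ha : a * (1 - toC A) = 1 + toC A) {z : ℂ} (hz : z ∈ spectrum ℂ a) : ‖z‖ < 1 := by
  have hdet : (1 - toC A).det ≠ 0 := by
    have := hA.det_ne_zero (s := 1) (by simp)
    simpa using this
  rw [Matrix.mem_spectrum_iff_isRoot_charpoly, IsRoot, Matrix.eval_charpoly] at hz
  obtain ⟨v, hv0, hv⟩ := Matrix.exists_mulVec_eq_zero_iff.2 hz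
  rw [Matrix.sub_mulVec, Matrix.scalar_apply, ← Matrix.smul_one_eq_diagonal,
    Matrix.smul_mulVec, Matrix.one_mulVec, sub_eq_zero] at hv
  set y := (1 - toC A)⁻¹ *ᵥ v with hy
  have hvy : v = (1 - toC A) *ᵥ y := by
    rw [hy, Matrix.mulVec_mulVec, Matrix.mul_nonsing_inv _ (isUnit_iff_ne_zero.2 hdet),
      Matrix.one_mulVec]
  have hy0 : y ≠ 0 := by
    intro h; rw [h, Matrix.mulVec_zero] at hvy; exact hv0 hvy
  have h1 : (1 + toC A) *ᵥ y = z • ((1 - toC A) *ᵥ y) := by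
    rw [← ha, ← Matrix.mulVec_mulVec, ← hvy, hv]
  have h2 : (1 + z) • (toC A *ᵥ y) = (z - 1) • y := by
    rw [Matrix.add_mulVec, Matrix.sub_mulVec, Matrix.one_mulVec, smul_sub] at h1
    linear_combination (norm := module) h1
  have hz1 : 1 + z ≠ 0 := by
    intro h
    rw [h, zero_smul] at h2
    have : z - 1 ≠ 0 := by
      rw [show z = -1 by linear_combination h]; norm_num
    exact hy0 ((smul_eq_zero.1 h2.symm).resolve_left this)
  have h3 : toC A *ᵥ y = ((z - 1) / (1 + z)) • y := by
    rw [div_eq_inv_mul, mul_smul, ← h2, smul_smul, inv_mul_cancel₀ hz1, one_smul]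
  have h4 : ((z - 1) / (1 + z)).re < 0 := by
    by_contra h
    exact hy0 (hA.eq_zero_of_eigenvector (not_lt.1 h) h3)
  have h5 : 0 < Complex.normSq (1 + z) := Complex.normSq_pos.2 hz1
  have h6 : ((z - 1) / (1 + z)).re = (Complex.normSq z - 1) / Complex.normSq (1 + z) := by
    rw [Complex.div_re, ← add_div]
    congr 1
    simp [Complex.normSq_apply]; ring
  rw [h6, div_neg_iff] at h4
  have h7 : Complex.normSq z < 1 := by
    rcases h4 with h | h
    · linarith [h.2]
    · linarith [h.1]
  rw [Complex.normSq_eq_norm_sq] at h7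
  nlinarith [norm_nonneg z]

/-- A solution of a strict Lyapunov inequality for a Hurwitz matrix is positive definite. -/
theorem IsHurwitz.lyapunov_pos {A P : Matrix n n ℝ} (hA : IsHurwitz A) (hP : Pᵀ = P)
    (hneg : ∀ x : n → ℝ, x ≠ 0 → x ⬝ᵥ (P *ᵥ (A *ᵥ x)) < 0) {x : n → ℝ} (hx : x ≠ 0) :
    0 < x ⬝ᵥ (P *ᵥ x) := by
  have htoC : toC (1 - A) = 1 - toC A := by
    rw [toC, Matrix.map_sub _ (by simp), Matrix.map_one _ (by simp) (by simp)]
  have hdet : (1 - A).det ≠ 0 := by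
    intro h
    have h1 := hA.det_ne_zero (s := 1) (by simp)
    apply h1
    have h2 : (toC (1 - A)).det = 0 := by
      have := (RingHom.map_det (algebraMap ℝ ℂ) (1 - A)).symm
      rw [h, map_zero] at this
      exact this
    rw [htoC] at h2
    simpa using h2
  -- The Cayley transform replaces the flow by a discrete iteration: with `y = u - A u` and `B y = u
  -- + A u`, the form changes by `4 u ⬝ᵥ P A u < 0`. As `B ^ k x` tends to zero, the form decreases
  -- strictly towards `0` and must start positive.
  set B : Matrix n n ℝ := (1 + A) * (1 - A)⁻¹ with hB
  have hB1 : B * (1 - A) = 1 + A := by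
    rw [hB, Matrix.mul_assoc, Matrix.nonsing_inv_mul _ (isUnit_iff_ne_zero.2 hdet), Matrix.mul_one]
  have hBC : toC B * (1 - toC A) = 1 + toC A := by
    rw [← htoC, ← toC_mul, hB1, toC, Matrix.map_add _ (by simp),
      Matrix.map_one _ (by simp) (by simp)]
  have hdec : ∀ y : n → ℝ, y ≠ 0 → (B *ᵥ y) ⬝ᵥ (P *ᵥ (B *ᵥ y)) < y ⬝ᵥ (P *ᵥ y) := by
    intro y hy
    set u := (1 - A)⁻¹ *ᵥ y with hu
    have hyu : y = u - A *ᵥ u := by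
      have : y = (1 - A) *ᵥ u := by
        rw [hu, Matrix.mulVec_mulVec, Matrix.mul_nonsing_inv _ (isUnit_iff_ne_zero.2 hdet),
          Matrix.one_mulVec]
      rw [this, Matrix.sub_mulVec, Matrix.one_mulVec]
    have hu0 : u ≠ 0 := by
      intro h; rw [h] at hyu; exact hy (by simpa using hyu)
    have hBy : B *ᵥ y = u + A *ᵥ u := by
      rw [hB, ← Matrix.mulVec_mulVec, ← hu, Matrix.add_mulVec, Matrix.one_mulVec]
    have h1 := hneg u hu0
    rw [hBy, hyu]
    have h2 : (A *ᵥ u) ⬝ᵥ (P *ᵥ u) = u ⬝ᵥ (P *ᵥ (A *ᵥ u)) := by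
      rw [dotProduct_mulVec_symm hP, dotProduct_comm]
    simp only [Matrix.mulVec_add, Matrix.mulVec_sub, add_dotProduct, sub_dotProduct,
      dotProduct_add, dotProduct_sub, h2]
    linarith
  have hpow : ∀ i, Tendsto (fun k => (B ^ k *ᵥ x) i) atTop (𝓝 0) := by
    intro i
    have h1 := tendsto_pow_of_spectrum fun z hz => hA.cayley_spectrum hBC hz
    have h2 : Tendsto (fun k => ‖((B ^ k *ᵥ x) i)‖) atTop (𝓝 0) := by
      refine squeeze_zero (fun k => norm_nonneg _) (fun k => ?_)
        (by simpa using h1.mul_const ‖fun j => (x j : ℂ)‖)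
      have h3 : (toC B ^ k *ᵥ fun j => (x j : ℂ)) i = (((B ^ k *ᵥ x) i : ℝ) : ℂ) := by
        have : toC B ^ k = toC (B ^ k) :=
          (map_pow (algebraMap ℝ ℂ).mapMatrix B k).symm
        rw [this]
        simp [toC, Matrix.mulVec, dotProduct]
      calc ‖(B ^ k *ᵥ x) i‖ = ‖(toC B ^ k *ᵥ fun j => (x j : ℂ)) i‖ := by
            rw [h3, Complex.norm_real]
        _ ≤ ‖toC B ^ k *ᵥ fun j => (x j : ℂ)‖ := norm_le_pi_norm _ i
        _ ≤ _ := Matrix.linfty_opNorm_mulVec _ _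
    exact tendsto_zero_iff_norm_tendsto_zero.2 h2
  set V : ℕ → ℝ := fun k => (B ^ k *ᵥ x) ⬝ᵥ (P *ᵥ (B ^ k *ᵥ x)) with hV
  have hVlim : Tendsto V atTop (𝓝 0) := by
    have hvec : Tendsto (fun k => B ^ k *ᵥ x) atTop (𝓝 0) := tendsto_pi_nhds.2 hpow
    have hcont : Continuous fun y : n → ℝ => y ⬝ᵥ (P *ᵥ y) := by fun_prop
    have := (hcont.tendsto 0).comp hvec
    rwa [Matrix.mulVec_zero, dotProduct_zero] at this
  have hVanti : Antitone V := by
    refine antitone_nat_of_succ_le fun k => ?_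
    have hs : B ^ (k + 1) *ᵥ x = B *ᵥ (B ^ k *ᵥ x) := by
      rw [pow_succ', Matrix.mulVec_mulVec]
    simp only [hV, hs]
    by_cases h0 : B ^ k *ᵥ x = 0
    · simp [h0]
    · exact (hdec _ h0).le
  have h1 : 0 ≤ V 1 := hVanti.le_of_tendsto hVlim 1
  have h2 : V 1 < V 0 := by
    simp only [hV, pow_one, pow_zero, Matrix.one_mulVec]
    exact hdec x hx
  simpa [hV] using h1.trans_lt h2

end Lyapunov

/-! ### Norm bounds for quadratic and bilinear forms. -/

section Bounds

variable {n : Type*} [Fintype n]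

/-- A positive definite form dominates the square of the norm. -/
lemma exists_quadratic_lower_bound (Q : Matrix n n ℝ)
    (hQ : ∀ x : n → ℝ, x ≠ 0 → 0 < x ⬝ᵥ (Q *ᵥ x)) :
    ∃ m : ℝ, 0 < m ∧ ∀ x : n → ℝ, m * ‖x‖ ^ 2 ≤ x ⬝ᵥ (Q *ᵥ x) := by
  have hcont : Continuous fun y : n → ℝ => y ⬝ᵥ (Q *ᵥ y) := by fun_prop
  have key : ∃ m : ℝ, 0 < m ∧ ∀ y ∈ Metric.sphere (0 : n → ℝ) 1, m ≤ y ⬝ᵥ (Q *ᵥ y) := by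
    rcases (Metric.sphere (0 : n → ℝ) 1).eq_empty_or_nonempty with h | h
    · exact ⟨1, one_pos, by simp [h]⟩
    · obtain ⟨y, hy, hmin⟩ := (isCompact_sphere (0 : n → ℝ) 1).exists_isMinOn h hcont.continuousOn
      exact ⟨_, hQ y (ne_zero_of_mem_unit_sphere ⟨y, hy⟩), fun z hz => hmin hz⟩
  obtain ⟨m, hm, hbound⟩ := key
  refine ⟨m, hm, fun x => ?_⟩
  by_cases hx : x = 0
  · simp [hx]
  have hx0 : 0 < ‖x‖ := norm_pos_iff.2 hx
  have h1 := hbound (‖x‖⁻¹ • x) (by simp [norm_smul, hx])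
  rw [Matrix.mulVec_smul, smul_dotProduct, dotProduct_smul, smul_eq_mul, smul_eq_mul] at h1
  calc m * ‖x‖ ^ 2 ≤ (‖x‖⁻¹ * (‖x‖⁻¹ * (x ⬝ᵥ (Q *ᵥ x)))) * ‖x‖ ^ 2 := by gcongr
    _ = _ := by field_simp

/-- Bilinear forms on coordinate spaces are bounded. -/
lemma exists_bilinear_bound {m : Type*} [Fintype m] (Q : Matrix n m ℝ) :
    ∃ C : ℝ, 0 ≤ C ∧ ∀ (x : n → ℝ) (y : m → ℝ), |x ⬝ᵥ (Q *ᵥ y)| ≤ C * (‖x‖ * ‖y‖) := by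
  refine ⟨∑ i, ∑ j, |Q i j|, by positivity, fun x y => ?_⟩
  simp only [dotProduct, Matrix.mulVec, Finset.mul_sum, Finset.sum_mul]
  refine (Finset.abs_sum_le_sum_abs _ _).trans (Finset.sum_le_sum fun i _ => ?_)
  refine (Finset.abs_sum_le_sum_abs _ _).trans (Finset.sum_le_sum fun j _ => ?_)
  rw [abs_mul, abs_mul]
  have h1 : |x i| ≤ ‖x‖ := norm_le_pi_norm x i
  have h2 : |y j| ≤ ‖y‖ := norm_le_pi_norm y j
  calc |x i| * (|Q i j| * |y j|) = |Q i j| * (|x i| * |y j|) := by ring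
    _ ≤ _ := by gcongr

end Bounds

/-! ### Lyapunov functions along solutions of reset systems -/

/-- Continuous induction for properties that are closed from the left and open to the right. -/
lemma forall_ge_of_left_closed_right_open {p : ℝ → Prop} {t₀ : ℝ} (h0 : p t₀)
    (hl : ∀ t, t₀ < t → (∀ s, t₀ ≤ s → s < t → p s) → p t)
    (hr : ∀ t, t₀ ≤ t → p t → ∀ᶠ s in 𝓝[>] t, p s) : ∀ t, t₀ ≤ t → p t := by
  intro t₁ ht₁
  by_contra hcon
  set B : Set ℝ := {t | t₀ ≤ t ∧ ¬ p t} with hB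
  have hne : B.Nonempty := ⟨t₁, ht₁, hcon⟩
  have hbdd : BddBelow B := ⟨t₀, fun t ht => ht.1⟩
  set τ := sInf B with hτ
  have hτ0 : t₀ ≤ τ := le_csInf hne fun t ht => ht.1
  have hbefore : ∀ s, t₀ ≤ s → s < τ → p s := by
    intro s hs hsτ
    by_contra hps
    exact absurd (csInf_le hbdd (show s ∈ B from ⟨hs, hps⟩)) (not_le.2 hsτ)
  have hpτ : p τ := by
    rcases hτ0.eq_or_lt with h | h
    · rwa [← h]
    · exact hl τ h hbefore
  obtain ⟨u, hu, hioo⟩ := mem_nhdsGT_iff_exists_Ioo_subset.1 (hr τ hτ0 hpτ)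
  obtain ⟨s, hsB, hsu⟩ := exists_lt_of_csInf_lt hne (show sInf B < u from hu)
  have hτs : τ ≤ s := csInf_le hbdd hsB
  rcases hτs.eq_or_lt with h | h
  · exact hsB.2 (h ▸ hpτ)
  · exact hsB.2 (hioo ⟨h, hsu⟩)

/-- A function that is at most `M` at `t` and has a negative right derivative there whenever it
equals `M` stays at most `M` immediately after `t`. -/
lemma eventually_le_of_hasDerivWithinAt {g : ℝ → ℝ} {g' t M : ℝ}
    (hg : HasDerivWithinAt g g' (Set.Ici t) t) (hM : g t ≤ M) (hneg : g t = M → g' < 0) :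
    ∀ᶠ s in 𝓝[>] t, g s ≤ M := by
  rcases hM.eq_or_lt with h | h
  · have hs : Tendsto (slope g t) (𝓝[>] t) (𝓝 g') := by
      have := hasDerivWithinAt_iff_tendsto_slope.1 hg
      rwa [Set.Ici_sdiff_left] at this
    filter_upwards [hs.eventually_lt_const (hneg h), self_mem_nhdsWithin] with s hs1 hs2
    have hpos : 0 < s - t := sub_pos.2 hs2
    rw [slope_def_field, div_neg_iff] at hs1
    rcases hs1 with h1 | h1
    · linarith [h1.2]
    · linarith [h1.1]
  · have hc : Tendsto g (𝓝[>] t) (𝓝 (g t)) :=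
      hg.continuousWithinAt.tendsto.mono_left (nhdsWithin_mono t Set.Ioi_subset_Ici_self)
    filter_upwards [hc.eventually_lt_const h] with s hs using hs.le

section Systems

variable {N : Type*} [Fintype N]

lemma hasDerivWithinAt_quadratic {P : Matrix N N ℝ} (hP : Pᵀ = P) {x : ℝ → N → ℝ} {x' : N → ℝ}
    {s : Set ℝ} {t : ℝ} (hx : HasDerivWithinAt x x' s t) :
    HasDerivWithinAt (fun t => x t ⬝ᵥ (P *ᵥ x t)) (2 * (x t ⬝ᵥ (P *ᵥ x'))) s t := by
  have hxi := hasDerivWithinAt_pi.1 hx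
  have h : HasDerivWithinAt (fun t => ∑ i, x t i * ∑ j, P i j * x t j)
      (∑ i, (x' i * ∑ j, P i j * x t j + x t i * ∑ j, P i j * x' j)) s t :=
    HasDerivWithinAt.fun_sum fun i _ =>
      (hxi i).mul (HasDerivWithinAt.fun_sum fun j _ => (hxi j).const_mul _)
  have e : ∑ i, (x' i * ∑ j, P i j * x t j + x t i * ∑ j, P i j * x' j) =
      2 * (x t ⬝ᵥ (P *ᵥ x')) := by
    have h1 : x' ⬝ᵥ (P *ᵥ x t) = x t ⬝ᵥ (P *ᵥ x') := by
      rw [dotProduct_mulVec_symm hP, dotProduct_comm]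
    rw [Finset.sum_add_distrib]
    change x' ⬝ᵥ (P *ᵥ x t) + x t ⬝ᵥ (P *ᵥ x') = _
    rw [h1]; ring
  rw [← e]
  exact h

variable [DecidableEq N]

namespace ResetSystem

/-- A quadratic Lyapunov certificate for a reset system in which the state with index `i₀` is
multiplied by `γ` at the reset instants. -/
structure Certificate (S : ResetSystem N) (i₀ : N) (γ β : ℝ) (P : Matrix N N ℝ) : Prop where
  gamma_lt : |γ| < 1
  reset : ∀ x, S.Aρ *ᵥ x = x + Pi.single i₀ ((γ - 1) * x i₀)
  symm : Pᵀ = P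
  col : P *ᵥ Pi.single i₀ 1 = Pi.single i₀ 1 + β • S.Ce
  trigger : S.Ce i₀ = 0
  pos : ∀ x : N → ℝ, x ≠ 0 → 0 < x ⬝ᵥ (P *ᵥ x)
  neg : ∀ x : N → ℝ, x ≠ 0 → x ⬝ᵥ (P *ᵥ (S.A *ᵥ x)) < 0

variable {S : ResetSystem N} {i₀ : N} {γ β : ℝ} {P : Matrix N N ℝ}

lemma Certificate.ne_zero_of_reset (h : S.Certificate i₀ γ β P) {x : N → ℝ}
    (hx : (1 - S.Aρ).mulVec x ≠ 0) : x i₀ ≠ 0 := by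
  intro h0
  apply hx
  rw [Matrix.sub_mulVec, Matrix.one_mulVec, h.reset, h0]
  simp

/-- The jump is along the unit vector `y`. Its column `P y` is prescribed by `col`, `y ⬝ᵥ P y = 1`
because `Ce i₀ = 0`, and the trigger condition eliminates `Ce ⬝ᵥ x`. -/
lemma Certificate.jump (h : S.Certificate i₀ γ β P) {x : N → ℝ} {ρ : ℝ}
    (he : S.Ce ⬝ᵥ x + S.De * ρ = 0) :
    (S.Aρ *ᵥ x) ⬝ᵥ (P *ᵥ (S.Aρ *ᵥ x)) = x ⬝ᵥ (P *ᵥ x) - (1 - γ ^ 2) * x i₀ ^ 2 +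
      2 * (1 - γ) * (β * S.De * ρ) * x i₀ := by
  set y : N → ℝ := Pi.single i₀ 1 with hy
  have h1 : S.Aρ *ᵥ x = x + ((γ - 1) * x i₀) • y := by
    rw [h.reset, hy]
    congr 1
    ext i
    by_cases hi : i = i₀ <;> simp [hi]
  have h2 : x ⬝ᵥ (P *ᵥ y) = x i₀ - β * S.De * ρ := by
    rw [h.col, dotProduct_add, dotProduct_smul, dotProduct_comm x S.Ce]
    simp only [dotProduct_single, mul_one, smul_eq_mul]
    linear_combination β * he
  have h3 : y ⬝ᵥ (P *ᵥ x) = x ⬝ᵥ (P *ᵥ y) := by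
    rw [dotProduct_mulVec_symm h.symm, dotProduct_comm]
  have h4 : y ⬝ᵥ (P *ᵥ y) = 1 := by
    rw [h.col, dotProduct_add, dotProduct_smul, hy]
    simp [h.trigger]
  rw [h1]
  simp only [Matrix.mulVec_add, Matrix.mulVec_smul, add_dotProduct, smul_dotProduct,
    dotProduct_add, dotProduct_smul, h3, h4, h2, smul_eq_mul]
  ring

lemma tendsto_left {t₀ : ℝ} {x₀ : N → ℝ} {w : ℝ → Fin 2 → ℝ} {x : ℝ → N → ℝ}
    (hx : S.IsSolution t₀ x₀ w x) {t : ℝ} (ht : t₀ < t) : Tendsto x (𝓝[<] t) (𝓝 (x t)) :=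
  (hx.left_cont t ht).tendsto.mono_left (nhdsWithin_mono t Set.Iio_subset_Iic_self)

/-- Exponential decay of solutions without external input. -/
theorem Certificate.exists_exponential_bound (h : S.Certificate i₀ γ β P) :
    ∃ k a : ℝ, 0 < k ∧ 0 < a ∧ ∀ (t₀ : ℝ) (x₀ : N → ℝ) (x : ℝ → N → ℝ),
      S.IsSolution t₀ x₀ 0 x → ∀ t, t₀ ≤ t →
        ‖x t‖ ^ 2 ≤ k * Real.exp (-(a * (t - t₀))) * ‖x₀‖ ^ 2 := by
  obtain ⟨m, hm, hmP⟩ := exists_quadratic_lower_bound P h.pos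
  obtain ⟨C, hC0, hCP⟩ := exists_bilinear_bound P
  obtain ⟨ε, hε, hεQ⟩ := exists_quadratic_lower_bound (-(P * S.A)) (by
    intro x hx
    have := h.neg x hx
    rw [Matrix.neg_mulVec, dotProduct_neg, ← Matrix.mulVec_mulVec]
    linarith)
  have hup : ∀ x : N → ℝ, x ⬝ᵥ (P *ᵥ x) ≤ C * ‖x‖ ^ 2 := fun x => by
    have := (le_abs_self _).trans (hCP x x)
    rwa [← sq] at this
  -- The flow dissipates at least `2 ε ‖x‖ ^ 2`; this rate makes `a V` consume at most half of it,
  -- so the weighted function decreases strictly. The `+ 1` guards against `C = 0`.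
  set a : ℝ := ε / (C + 1) with ha
  have ha0 : 0 < a := by positivity
  refine ⟨(C + 1) / m, a, by positivity, ha0, fun t₀ x₀ x hx t ht => ?_⟩
  set V : ℝ → ℝ := fun t => x t ⬝ᵥ (P *ᵥ x t) with hV
  set g : ℝ → ℝ := fun t => Real.exp (a * (t - t₀)) * V t with hg
  have hquad : Continuous fun y : N → ℝ => y ⬝ᵥ (P *ᵥ y) := by fun_prop
  have hexp : Continuous fun t : ℝ => Real.exp (a * (t - t₀)) := by fun_prop
  -- positivity of `M` makes the state nonzero where `g = M`
  have key : ∀ M : ℝ, 0 < M → V t₀ ≤ M → ∀ t, t₀ ≤ t → g t ≤ M := by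
    intro M hM hM0
    refine forall_ge_of_left_closed_right_open (by simpa [hg] using hM0) ?_ ?_
    · intro t ht hbefore
      have hlim : Tendsto g (𝓝[<] t) (𝓝 (g t)) :=
        (hexp.continuousWithinAt.tendsto).mul ((hquad.tendsto _).comp (tendsto_left hx ht))
      refine le_of_tendsto hlim ?_
      filter_upwards [Ioo_mem_nhdsLT ht] with s hs using hbefore s hs.1.le hs.2
    · intro t ht hgt
      by_cases hres : t ∈ S.resetInstants t₀ 0 x
      · have hx0 := h.ne_zero_of_reset hres.2.2
        have he : S.Ce ⬝ᵥ x t + S.De * 0 = 0 := by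
          simpa [ResetSystem.er] using hres.2.1
        have hj := h.jump he
        have hlt : (S.Aρ *ᵥ x t) ⬝ᵥ (P *ᵥ (S.Aρ *ᵥ x t)) < V t := by
          rw [hj]
          have : 0 < (1 - γ ^ 2) * x t i₀ ^ 2 := by
            have := (sq_lt_one_iff_abs_lt_one γ).2 h.gamma_lt
            have := sub_pos.2 this
            positivity
          simp only [hV]
          linarith
        have hlim : Tendsto g (𝓝[>] t) (𝓝 (Real.exp (a * (t - t₀)) *
            ((S.Aρ *ᵥ x t) ⬝ᵥ (P *ᵥ (S.Aρ *ᵥ x t))))) :=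
          (hexp.continuousWithinAt.tendsto).mul ((hquad.tendsto _).comp (hx.jump t hres))
        have hlt' : Real.exp (a * (t - t₀)) * ((S.Aρ *ᵥ x t) ⬝ᵥ (P *ᵥ (S.Aρ *ᵥ x t))) < M :=
          (mul_lt_mul_of_pos_left hlt (Real.exp_pos _)).trans_le hgt
        filter_upwards [hlim.eventually_lt_const hlt'] with s hs using hs.le
      · have hd := hasDerivWithinAt_quadratic h.symm (hx.flow t ht hres)
        have hde : HasDerivWithinAt (fun t : ℝ => Real.exp (a * (t - t₀)))
            (Real.exp (a * (t - t₀)) * (a * 1)) (Set.Ici t) t :=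
          ((((hasDerivAt_id t).sub_const t₀).const_mul a).exp).hasDerivWithinAt
        refine eventually_le_of_hasDerivWithinAt (hde.mul hd) hgt fun hEq => ?_
        have hxt : x t ≠ 0 := by
          intro h0
          have : g t = 0 := by simp [hg, hV, h0]
          linarith [show g t = M from hEq]
        have hn : 0 < ‖x t‖ := norm_pos_iff.2 hxt
        have h1 := hεQ (x t)
        rw [Matrix.neg_mulVec, dotProduct_neg, ← Matrix.mulVec_mulVec] at h1
        have h2 : a * V t ≤ ε * ‖x t‖ ^ 2 := by
          calc a * V t ≤ a * ((C + 1) * ‖x t‖ ^ 2) := by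
                gcongr
                exact (hup (x t)).trans (by gcongr; linarith)
            _ = ε * ‖x t‖ ^ 2 := by rw [ha]; field_simp
        have h3 : x t ⬝ᵥ (P *ᵥ (S.A *ᵥ x t + S.B *ᵥ (0 : ℝ → Fin 2 → ℝ) t)) =
            x t ⬝ᵥ (P *ᵥ (S.A *ᵥ x t)) := by simp
        rw [h3]
        have h4 : 0 < ε * ‖x t‖ ^ 2 := by positivity
        have h5 : Real.exp (a * (t - t₀)) * (a * 1) * (x t ⬝ᵥ (P *ᵥ x t)) +
            Real.exp (a * (t - t₀)) * (2 * (x t ⬝ᵥ (P *ᵥ (S.A *ᵥ x t)))) =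
            Real.exp (a * (t - t₀)) * (a * V t + 2 * (x t ⬝ᵥ (P *ᵥ (S.A *ᵥ x t)))) := by
          simp only [hV]; ring
        rw [h5]
        exact mul_neg_of_pos_of_neg (Real.exp_pos _) (by linarith)
  have hVt0 : V t₀ ≤ C * ‖x₀‖ ^ 2 := by
    simp only [hV, hx.init]; exact hup x₀
  have hgt : g t ≤ (C + 1) * ‖x₀‖ ^ 2 := by
    -- The slack `η` keeps the level positive when `x₀ = 0`.
    refine le_of_forall_pos_le_add fun η hη => key _ (by positivity) ?_ t ht
    nlinarith [sq_nonneg ‖x₀‖]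
  have h1 : m * ‖x t‖ ^ 2 ≤ V t := hmP (x t)
  have h2 : V t = Real.exp (-(a * (t - t₀))) * g t := by
    simp only [hg]; rw [← mul_assoc, ← Real.exp_add]; simp
  have h3 : V t ≤ Real.exp (-(a * (t - t₀))) * ((C + 1) * ‖x₀‖ ^ 2) := by
    rw [h2]; gcongr
  calc ‖x t‖ ^ 2 = (m * ‖x t‖ ^ 2) / m := by field_simp
    _ ≤ (Real.exp (-(a * (t - t₀))) * ((C + 1) * ‖x₀‖ ^ 2)) / m := by
        exact div_le_div_of_nonneg_right (h1.trans h3) hm.le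
    _ = _ := by ring

lemma isSolution_zero : ∀ t₀ : ℝ, S.IsSolution t₀ 0 0 (fun _ => 0) := by
  intro t₀
  have hno : ∀ t, t ∉ S.resetInstants t₀ 0 (fun _ => 0) := fun t ht => ht.2.2 (by simp)
  refine ⟨rfl, fun t _ => continuousWithinAt_const, fun t _ _ => ?_, fun t ht => (hno t ht).elim⟩
  simpa using hasDerivWithinAt_const t (Set.Ici t) (0 : N → ℝ)

theorem Certificate.isGUAS (h : S.Certificate i₀ γ β P) : S.IsGUAS := by
  obtain ⟨k, a, hk, ha, hdecay⟩ := h.exists_exponential_bound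
  have hbound : ∀ (t₀ : ℝ) (x₀ : N → ℝ) (x : ℝ → N → ℝ), S.IsSolution t₀ x₀ 0 x →
      ∀ t, t₀ ≤ t → ‖x t‖ ≤ √k * ‖x₀‖ := by
    intro t₀ x₀ x hx t ht
    have h1 := hdecay t₀ x₀ x hx t ht
    have h2 : Real.exp (-(a * (t - t₀))) ≤ 1 :=
      Real.exp_le_one_iff.2 (neg_nonpos.2 (mul_nonneg ha.le (sub_nonneg.2 ht)))
    refine abs_le_of_sq_le_sq' ?_ (by positivity) |>.2
    rw [mul_pow, Real.sq_sqrt hk.le]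
    refine h1.trans ?_
    gcongr
    exact mul_le_of_le_one_right hk.le h2
  have hsk : 0 < √k := Real.sqrt_pos.2 hk
  refine ⟨fun t₀ _ => isSolution_zero t₀, fun ε hε => ⟨ε / √k, by positivity, ?_⟩,
    fun R hR => ⟨√k * R, by positivity, ?_⟩, fun R hR ε hε => ?_⟩
  · intro t₀ _ x₀ x hx hx₀ t ht
    calc ‖x t‖ ≤ √k * ‖x₀‖ := hbound t₀ x₀ x hx t ht
      _ ≤ √k * (ε / √k) := by gcongr
      _ = ε := by field_simp
  · intro t₀ _ x₀ x hx hx₀ t ht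
    exact (hbound t₀ x₀ x hx t ht).trans (by gcongr)
  · have hlim : Tendsto (fun T : ℝ => k * Real.exp (-(a * T)) * R ^ 2) atTop (𝓝 0) := by
      have h1 : Tendsto (fun T : ℝ => Real.exp (-(a * T))) atTop (𝓝 0) :=
        Real.tendsto_exp_neg_atTop_nhds_zero.comp (tendsto_id.const_mul_atTop ha)
      simpa using (h1.const_mul k).mul_const (R ^ 2)
    obtain ⟨T, hT, hT0⟩ := ((hlim.eventually_lt_const (show (0 : ℝ) < ε ^ 2 by positivity)).and
      (eventually_gt_atTop 0)).exists
    refine ⟨T, hT0, fun t₀ _ x₀ x hx hx₀ t ht => ?_⟩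
    refine abs_le_of_sq_le_sq' ?_ hε.le |>.2
    refine (hdecay t₀ x₀ x hx t (by linarith)).trans (le_trans ?_ hT.le)
    have : T ≤ t - t₀ := by linarith
    gcongr

/-- The weighted functions `V ± κ x i₀`, with `V` the quadratic Lyapunov function, bound the growth
of `V` at the reset instants by the growth of the reset state between them. Hence the bound on the
state does not depend on the distances of the reset instants, and the reset instants need not even
be separated. -/
theorem Certificate.isUBIBS (h : S.Certificate i₀ γ β P) (𝒲 : Set (ℝ → Fin 2 → ℝ)) :
    S.IsUBIBS 𝒲 := by
  intro R hR
  obtain ⟨m, hm, hmP⟩ := exists_quadratic_lower_bound P h.pos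
  obtain ⟨C, hC0, hCP⟩ := exists_bilinear_bound P
  obtain ⟨D, hD0, hDP⟩ := exists_bilinear_bound (P * S.B)
  obtain ⟨a₁, ha₁, hA⟩ := exists_bilinear_bound S.A
  obtain ⟨b₁, hb₁, hB⟩ := exists_bilinear_bound S.B
  obtain ⟨ε, hε, hεQ⟩ := exists_quadratic_lower_bound (-(P * S.A)) (by
    intro x hx
    have := h.neg x hx
    rw [Matrix.neg_mulVec, dotProduct_neg, ← Matrix.mulVec_mulVec]
    linarith)
  have hγ := h.gamma_lt
  have hγ1 : 0 < 1 - |γ| := sub_pos.2 hγ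
  have hγ2 : γ < 1 := (abs_lt.1 hγ).2
  -- weight of the reset state in the Lyapunov functions
  set κ : ℝ := 2 * (1 - γ) * |β * S.De| * R / (1 - |γ|) with hκ
  have hκ0 : 0 ≤ κ := by
    have : 0 ≤ 1 - γ := by linarith
    positivity
  have hsingle : ‖(Pi.single i₀ 1 : N → ℝ)‖ ≤ 1 := by
    rw [pi_norm_le_iff_of_nonneg zero_le_one]
    intro i
    by_cases hi : i = i₀ <;> simp [hi]
  -- `q ‖x‖` bounds all contributions of the input and of the weight `κ` along the flow once `1 ≤
  -- ‖x‖`. Hence `ρ` is at least `1`, at least `q / ε` so that dissipation wins outside the ball,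
  -- and at least `R` so that the ball contains the initial states. `M` exceeds both functions on
  -- the ball.
  set q : ℝ := 2 * D * R + κ * a₁ + κ * b₁ * R with hq
  have hq0 : 0 ≤ q := by positivity
  set ρ : ℝ := max (max 1 R) (q / ε) with hρ
  have hρ1 : 1 ≤ ρ := (le_max_left _ _).trans (le_max_left _ _)
  have hρR : R ≤ ρ := (le_max_right _ _).trans (le_max_left _ _)
  have hρq : q / ε ≤ ρ := le_max_right _ _
  set M : ℝ := C * ρ ^ 2 + κ * ρ + 1 with hM
  have hM0 : 0 < M := by positivity
  set W : ℝ → (N → ℝ) → ℝ := fun σ x => x ⬝ᵥ (P *ᵥ x) + σ * κ * x i₀ with hW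
  have hWcont : ∀ σ, Continuous (W σ) := fun σ => by
    simp only [hW]; fun_prop
  have hWsmall : ∀ σ : ℝ, |σ| ≤ 1 → ∀ x : N → ℝ, ‖x‖ ≤ ρ → W σ x < M := by
    intro σ hσ x hx
    have h1 : x ⬝ᵥ (P *ᵥ x) ≤ C * ρ ^ 2 := by
      refine ((le_abs_self _).trans (hCP x x)).trans ?_
      rw [← sq]; gcongr
    have h2 : σ * κ * x i₀ ≤ κ * ρ := by
      calc σ * κ * x i₀ ≤ |σ * κ * x i₀| := le_abs_self _
        _ = |σ| * (κ * |x i₀|) := by rw [abs_mul, abs_mul, abs_of_nonneg hκ0]; ring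
        _ ≤ 1 * (κ * ρ) := by
            gcongr
            exact (norm_le_pi_norm x i₀).trans hx
        _ = κ * ρ := one_mul _
    simp only [hW, hM]; linarith
  have hflow : ∀ σ : ℝ, |σ| ≤ 1 → ∀ (x : N → ℝ) (v : Fin 2 → ℝ), ‖v‖ ≤ R → ρ < ‖x‖ →
      2 * (x ⬝ᵥ (P *ᵥ (S.A *ᵥ x + S.B *ᵥ v))) + σ * κ * (S.A *ᵥ x + S.B *ᵥ v) i₀ < 0 := by
    intro σ hσ x v hv hx
    have hx1 : 1 ≤ ‖x‖ := hρ1.trans hx.le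
    have h1 := hεQ x
    rw [Matrix.neg_mulVec, dotProduct_neg, ← Matrix.mulVec_mulVec] at h1
    have h2 : x ⬝ᵥ (P *ᵥ (S.B *ᵥ v)) ≤ D * R * ‖x‖ := by
      rw [Matrix.mulVec_mulVec]
      calc _ ≤ D * (‖x‖ * ‖v‖) := (le_abs_self _).trans (hDP x v)
        _ ≤ D * (‖x‖ * R) := by gcongr
        _ = _ := by ring
    have h3 : |(S.A *ᵥ x) i₀| ≤ a₁ * ‖x‖ := by
      have := hA (Pi.single i₀ 1) x
      rw [single_dotProduct, one_mul] at this
      refine this.trans ?_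
      gcongr
      exact mul_le_of_le_one_left (norm_nonneg _) hsingle
    have h4 : |(S.B *ᵥ v) i₀| ≤ b₁ * R := by
      have := hB (Pi.single i₀ 1) v
      rw [single_dotProduct, one_mul] at this
      refine this.trans ?_
      gcongr
      exact (mul_le_of_le_one_left (norm_nonneg _) hsingle).trans hv
    have h5 : σ * κ * (S.A *ᵥ x + S.B *ᵥ v) i₀ ≤ κ * a₁ * ‖x‖ + κ * b₁ * R * ‖x‖ := by
      calc σ * κ * (S.A *ᵥ x + S.B *ᵥ v) i₀ ≤ |σ * κ * (S.A *ᵥ x + S.B *ᵥ v) i₀| := le_abs_self _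
        _ = |σ| * (κ * |(S.A *ᵥ x) i₀ + (S.B *ᵥ v) i₀|) := by
            rw [abs_mul, abs_mul, abs_of_nonneg hκ0, Pi.add_apply]; ring
        _ ≤ 1 * (κ * (a₁ * ‖x‖ + b₁ * R)) := by
            gcongr
            exact (abs_add_le _ _).trans (add_le_add h3 h4)
        _ ≤ 1 * (κ * (a₁ * ‖x‖ + b₁ * R * ‖x‖)) := by
            have := le_mul_of_one_le_right (show 0 ≤ b₁ * R by positivity) hx1
            gcongr
        _ = _ := by ring
    have h6 : q * ‖x‖ ≤ ε * ‖x‖ ^ 2 := by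
      have : q ≤ ε * ‖x‖ := by
        have := (div_le_iff₀ hε).1 (hρq.trans hx.le)
        linarith
      nlinarith
    have h7 : 0 < ε * ‖x‖ ^ 2 := by positivity
    rw [Matrix.mulVec_add, dotProduct_add]
    have h8 : q * ‖x‖ = 2 * (D * R * ‖x‖) + (κ * a₁ * ‖x‖ + κ * b₁ * R * ‖x‖) := by
      rw [hq]; ring
    linarith
  refine ⟨√(M / m), by positivity, fun w hw hwR t₀ ht₀ x₀ x hx hx₀ => ?_⟩
  have key : ∀ t, t₀ ≤ t → W 1 (x t) ≤ M ∧ W (-1) (x t) ≤ M := by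
    refine forall_ge_of_left_closed_right_open ?_ ?_ ?_
    · rw [hx.init]
      exact ⟨(hWsmall 1 (by simp) x₀ (hx₀.trans hρR)).le,
        (hWsmall (-1) (by simp) x₀ (hx₀.trans hρR)).le⟩
    · intro t ht hbefore
      have hlim : ∀ σ, Tendsto (fun s => W σ (x s)) (𝓝[<] t) (𝓝 (W σ (x t))) := fun σ =>
        ((hWcont σ).tendsto _).comp (tendsto_left hx ht)
      constructor
      · refine le_of_tendsto (hlim 1) ?_
        filter_upwards [Ioo_mem_nhdsLT ht] with s hs using (hbefore s hs.1.le hs.2).1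
      · refine le_of_tendsto (hlim (-1)) ?_
        filter_upwards [Ioo_mem_nhdsLT ht] with s hs using (hbefore s hs.1.le hs.2).2
    · rintro t ht ⟨hp, hn⟩
      have hwt : ‖w t‖ ≤ R := hwR t (ht₀.trans ht)
      by_cases hres : t ∈ S.resetInstants t₀ w x
      · have hx0 := h.ne_zero_of_reset hres.2.2
        have hj := h.jump (x := x t) (ρ := w t 0) hres.2.1
        have hρw : |w t 0| ≤ R := (norm_le_pi_norm (w t) 0).trans hwt
        have habs : 0 < |x t i₀| := abs_pos.2 hx0
        have hkey : ∀ σ : ℝ, |σ| ≤ 1 → W σ (S.Aρ *ᵥ x t) < M := by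
          intro σ hσ
          have e1 : (S.Aρ *ᵥ x t) i₀ = γ * x t i₀ := by
            rw [h.reset]; simp; ring
          have e2 : σ * κ * (γ * x t i₀) ≤ κ * (|γ| * |x t i₀|) := by
            calc _ ≤ |σ * κ * (γ * x t i₀)| := le_abs_self _
              _ = |σ| * (κ * (|γ| * |x t i₀|)) := by
                  rw [abs_mul, abs_mul, abs_mul, abs_of_nonneg hκ0]; ring
              _ ≤ 1 * (κ * (|γ| * |x t i₀|)) := by gcongr
              _ = _ := one_mul _
          -- This is what fixes `κ`: the reset shrinks `κ |x i₀|` to `κ |γ| |x i₀|`, and the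
          -- released amount equals the largest possible gain of `V`.
          have e3 : 2 * (1 - γ) * (β * S.De * w t 0) * x t i₀ ≤
              κ * (1 - |γ|) * |x t i₀| := by
            have : κ * (1 - |γ|) = 2 * (1 - γ) * |β * S.De| * R := by
              rw [hκ]; field_simp
            rw [this]
            have h1γ : 0 ≤ 1 - γ := by linarith
            calc _ ≤ |2 * (1 - γ) * (β * S.De * w t 0) * x t i₀| := le_abs_self _
              _ = 2 * (1 - γ) * |β * S.De| * |w t 0| * |x t i₀| := by
                  rw [abs_mul, abs_mul, abs_mul (β * S.De), abs_of_nonneg (by positivity)]; ring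
              _ ≤ _ := by gcongr
          have e4 : 0 < (1 - γ ^ 2) * x t i₀ ^ 2 := by
            have := (sq_lt_one_iff_abs_lt_one γ).2 hγ
            have := sub_pos.2 this
            positivity
          -- The two signs together bound the function with the absolute value, while each of them
          -- stays differentiable along the flow.
          have e5 : x t ⬝ᵥ (P *ᵥ x t) + κ * |x t i₀| ≤ M := by
            simp only [hW] at hp hn
            rcases abs_cases (x t i₀) with h1 | h1 <;> rw [h1.1] <;> linarith
          simp only [hW]
          rw [hj, e1]
          linarith
        have hlim : ∀ σ, Tendsto (fun s => W σ (x s)) (𝓝[>] t) (𝓝 (W σ (S.Aρ *ᵥ x t))) :=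
          fun σ => ((hWcont σ).tendsto _).comp (hx.jump t hres)
        filter_upwards [(hlim 1).eventually_lt_const (hkey 1 (by simp)),
          (hlim (-1)).eventually_lt_const (hkey (-1) (by simp))] with s h1 h2 using ⟨h1.le, h2.le⟩
      · have hxd := hx.flow t ht hres
        have hd : ∀ σ : ℝ, HasDerivWithinAt (fun s => W σ (x s))
            (2 * (x t ⬝ᵥ (P *ᵥ (S.A *ᵥ x t + S.B *ᵥ w t))) +
              σ * κ * (S.A *ᵥ x t + S.B *ᵥ w t) i₀) (Set.Ici t) t := fun σ =>
          (hasDerivWithinAt_quadratic h.symm hxd).add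
            ((hasDerivWithinAt_pi.1 hxd i₀).const_mul _)
        have hbig : ∀ σ : ℝ, |σ| ≤ 1 → W σ (x t) = M → ρ < ‖x t‖ := by
          intro σ hσ hEq
          by_contra hcon
          exact (hWsmall σ hσ (x t) (not_lt.1 hcon)).ne hEq
        have h1 := eventually_le_of_hasDerivWithinAt (hd 1) hp fun hEq =>
          hflow 1 (by simp) _ _ hwt (hbig 1 (by simp) hEq)
        have h2 := eventually_le_of_hasDerivWithinAt (hd (-1)) hn fun hEq =>
          hflow (-1) (by simp) _ _ hwt (hbig (-1) (by simp) hEq)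
        exact h1.and h2
  intro t ht
  obtain ⟨hp, hn⟩ := key t ht
  have h1 := hmP (x t)
  simp only [hW] at hp hn
  refine Real.le_sqrt_of_sq_le ?_
  rw [le_div_iff₀ hm]
  linarith

end ResetSystem

end Systems

/-! ### Frequency responses -/

namespace LTI

variable {n : Type*} [Fintype n]

/-- `y` is the amplitude of an output of the form `y * exp (s t)` for the input `u * exp (s t)`. -/
def IsResponse (S : LTI n) (s u y : ℂ) : Prop :=
  ∃ z : n → ℂ, (∀ i, s * z i = ∑ j, (S.A i j : ℂ) * z j + S.b i * u) ∧
    y = ∑ i, (S.c i : ℂ) * z i + S.d * u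

variable [DecidableEq n]

lemma aeval_den (S : LTI n) (s : ℂ) : aeval s S.den = (Matrix.scalar n s - toC S.A).det := by
  rw [← Matrix.eval_charpoly, den, Polynomial.aeval_def, ← Polynomial.eval_map,
    ← Matrix.charpoly_map]

lemma aeval_num (S : LTI n) (s : ℂ) : aeval s S.num =
    (fun i => (S.c i : ℂ)) ⬝ᵥ ((Matrix.scalar n s - toC S.A).adjugate *ᵥ fun i => (S.b i : ℂ)) +
      S.d * aeval s S.den := by
  have h1 : ((aeval s : ℝ[X] →ₐ[ℝ] ℂ) : ℝ[X] →+* ℂ).mapMatrix S.A.charmatrix =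
      Matrix.scalar n s - toC S.A := by
    ext i j
    by_cases hij : i = j
    · subst hij; simp [charmatrix_apply_eq]
    · simp [hij]
  have h2 : (Matrix.scalar n s - toC S.A).adjugate =
      ((aeval s : ℝ[X] →ₐ[ℝ] ℂ) : ℝ[X] →+* ℂ).mapMatrix S.A.charmatrix.adjugate := by
    rw [RingHom.map_adjugate, h1]
  rw [h2, num, map_add, map_mul, aeval_C]
  simp [dotProduct, Matrix.mulVec]

lemma mulVec_of_response {S : LTI n} {s u : ℂ} {z : n → ℂ}
    (hz : ∀ i, s * z i = ∑ j, (S.A i j : ℂ) * z j + S.b i * u) :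
    (Matrix.scalar n s - toC S.A) *ᵥ z = u • fun i => (S.b i : ℂ) := by
  rw [Matrix.sub_mulVec, Matrix.scalar_apply, ← Matrix.smul_one_eq_diagonal,
    Matrix.smul_mulVec, Matrix.one_mulVec]
  ext i
  have h1 : (toC S.A *ᵥ z) i = ∑ j, (S.A i j : ℂ) * z j := rfl
  simp only [Pi.sub_apply, Pi.smul_apply, smul_eq_mul, hz i, h1]
  ring

/-- Using the adjugate instead of the inverse keeps the relation meaningful at poles, where the
transfer function is not available. -/
lemma IsResponse.den_mul {S : LTI n} {s u y : ℂ} (h : S.IsResponse s u y) :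
    aeval s S.den * y = aeval s S.num * u := by
  obtain ⟨z, hz, rfl⟩ := h
  have h1 := congrArg ((Matrix.scalar n s - toC S.A).adjugate *ᵥ ·) (mulVec_of_response hz)
  simp only [Matrix.mulVec_mulVec, Matrix.adjugate_mul, Matrix.smul_mulVec, Matrix.one_mulVec,
    Matrix.mulVec_smul, ← aeval_den] at h1
  have h2 := congrArg ((fun i => (S.c i : ℂ)) ⬝ᵥ ·) h1
  simp only [dotProduct_smul, smul_eq_mul] at h2
  change aeval s S.den * ((fun i => (S.c i : ℂ)) ⬝ᵥ z + S.d * u) = _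
  rw [aeval_num]
  linear_combination h2

lemma IsResponse.eq_tf {S : LTI n} {s u y : ℂ} (h : S.IsResponse s u y)
    (hs : aeval s S.den ≠ 0) : y = S.tf s * u := by
  obtain ⟨z, hz, rfl⟩ := h
  rw [aeval_den] at hs
  have h1 := congrArg ((Matrix.scalar n s - toC S.A)⁻¹ *ᵥ ·) (mulVec_of_response hz)
  simp only [Matrix.mulVec_mulVec, Matrix.nonsing_inv_mul _ (isUnit_iff_ne_zero.2 hs),
    Matrix.one_mulVec, Matrix.mulVec_smul] at h1
  change (fun i => (S.c i : ℂ)) ⬝ᵥ z + S.d * u = _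
  rw [h1, dotProduct_smul, smul_eq_mul, tf]
  ring

end LTI

/-! ### Responses of the loop to an excitation of the reset state. -/

section Loop

variable {ιG ι₁ ι₂ ιs : Type*} [Fintype ιG] [DecidableEq ιG] [Fintype ι₁] [DecidableEq ι₁]
  [Fintype ι₂] [DecidableEq ι₂] [Fintype ιs] [DecidableEq ιs]
  {G : LTI ιG} {CL₁ : LTI ι₁} {CL₂ : LTI ι₂} {Cs : LTI ιs} {ξ ωr γ : ℝ}

lemma closedLoop_A_inl_inl {m n : Type*} [DecidableEq n] (R : ResetElement m) (P : LinearPart n)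
    (i j : m) : (closedLoop R P).A (.inl i) (.inl j) = R.A i j := rfl

lemma closedLoop_A_inl_inr {m n : Type*} [DecidableEq n] (R : ResetElement m) (P : LinearPart n)
    (i : m) (j : n) : (closedLoop R P).A (.inl i) (.inr j) = R.b i * P.Cu j := rfl

lemma closedLoop_A_inr_inl {m n : Type*} [DecidableEq n] (R : ResetElement m) (P : LinearPart n)
    (i : n) (j : m) : (closedLoop R P).A (.inr i) (.inl j) = P.Bu i * R.c j := rfl

lemma closedLoop_A_inr_inr {m n : Type*} [DecidableEq n] (R : ResetElement m) (P : LinearPart n)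
    (i j : n) : (closedLoop R P).A (.inr i) (.inr j) = P.A i j + R.d * (P.Bu i * P.Cu j) := rfl

/-- The responses of the blocks of the loop when a unit amplitude excites the state that is
reset. -/
lemma responses_of_closedLoop (hG : G.d = 0) {s : ℂ} {X : Fin 2 ⊕ (ιG ⊕ ι₁ ⊕ ι₂ ⊕ ιs) → ℂ}
    (hX : s • X = toC (closedLoop (sosre ξ ωr γ) (linearPart G CL₁ CL₂ Cs)).A *ᵥ X +
      Pi.single (.inl 0) 1) :
    ∃ u₁ yG y₂ : ℂ, X (.inl 0) = s * X (.inl 1) ∧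
      ωr ^ 2 * X (.inl 1) = u₁ + 1 - (s + 2 * ξ * ωr) * X (.inl 0) ∧
      (sosre ξ ωr γ).toLTI.IsResponse s (u₁ + 1) (X (.inl 1)) ∧
      G.IsResponse s y₂ yG ∧ CL₁.IsResponse s (-yG) u₁ ∧ CL₂.IsResponse s (X (.inl 1)) y₂ ∧
      Cs.IsResponse s u₁
        (∑ i, ((closedLoop (sosre ξ ωr γ) (linearPart G CL₁ CL₂ Cs)).Ce i : ℂ) * X i) := by
  have hXi : ∀ i, s * X i = ∑ j, ((closedLoop (sosre ξ ωr γ) (linearPart G CL₁ CL₂ Cs)).A i j : ℂ)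
      * X j + (Pi.single (.inl 0) 1 : Fin 2 ⊕ (ιG ⊕ ι₁ ⊕ ι₂ ⊕ ιs) → ℂ) i := fun i => congrFun hX i
  set yG : ℂ := ∑ j, (G.c j : ℂ) * X (.inr (.inl j)) with hyG
  set y₂ : ℂ := ∑ j, (CL₂.c j : ℂ) * X (.inr (.inr (.inr (.inl j)))) + CL₂.d * X (.inl 1) with hy₂
  set u₁ : ℂ := ∑ j, (CL₁.c j : ℂ) * X (.inr (.inr (.inl j))) + CL₁.d * (-yG) with hu₁
  have e1 : X (.inl 0) = s * X (.inl 1) := by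
    have := hXi (.inl 1)
    rw [this]
    simp [closedLoop_A_inl_inl, closedLoop_A_inl_inr, sosre, linearPart]
  have e0 : s * X (.inl 0) =
      -(2 * ξ * ωr) * X (.inl 0) - ωr ^ 2 * X (.inl 1) + u₁ + 1 := by
    have := hXi (.inl 0)
    rw [this]
    simp [closedLoop_A_inl_inl, closedLoop_A_inl_inr, sosre, linearPart, hu₁, hyG, Finset.mul_sum, mul_assoc]
    ring
  refine ⟨u₁, yG, y₂, e1, by linear_combination e0, ⟨fun i => X (.inl i), ?_, ?_⟩,
    ⟨fun i => X (.inr (.inl i)), ?_, ?_⟩, ⟨fun i => X (.inr (.inr (.inl i))), ?_, hu₁⟩,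
    ⟨fun i => X (.inr (.inr (.inr (.inl i)))), ?_, hy₂⟩,
    ⟨fun i => X (.inr (.inr (.inr (.inr i)))), ?_, ?_⟩⟩
  · intro i
    fin_cases i
    · simp only [Fin.zero_eta, e0, sosre, Fin.sum_univ_two]; simp; ring
    · simp [sosre, Fin.sum_univ_two, ← e1]
  · simp [sosre]
  · intro i
    rw [hXi]
    simp [closedLoop_A_inr_inl, closedLoop_A_inr_inr, sosre, linearPart, hy₂, Finset.mul_sum, mul_assoc,
      mul_add]
    ring
  · simp [hG, hyG]
  · intro i
    rw [hXi]
    simp [closedLoop_A_inr_inl, closedLoop_A_inr_inr, sosre, linearPart, hyG, Finset.mul_sum, mul_assoc]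
    ring
  · intro i
    rw [hXi]
    simp [closedLoop_A_inr_inl, closedLoop_A_inr_inr, sosre, linearPart]
    ring
  · intro i
    rw [hXi]
    simp [closedLoop_A_inr_inl, closedLoop_A_inr_inr, sosre, linearPart, hu₁, hyG, Finset.mul_sum, mul_assoc,
      mul_add]
    ring
  · simp [closedLoop, linearPart, hu₁, hyG, Finset.mul_sum, mul_assoc, mul_add]
    ring

lemma aeval_openLoopDen (CR : LTI (Fin 2)) (s : ℂ) : aeval s (openLoopDen CR G CL₁ CL₂) =
    aeval s CL₁.den * aeval s CR.den * aeval s CL₂.den * aeval s G.den := by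
  simp [openLoopDen]

/-- At a frequency that is not a pole of the open loop, the Nyquist stability vector gives the
real parts of the closed-loop responses of the reset state and of the triggering signal. -/
lemma nsv_of_response {CR : LTI (Fin 2)} {ω : ℝ}
    (hω : ¬ HasPoleAt CR G CL₁ CL₂ ω) (hCs : IsHurwitz Cs.A) {u₁ yG y₂ x₁ x₂ er : ℂ}
    (hx : x₁ = Complex.I * ω * x₂) (hR : CR.IsResponse (Complex.I * ω) (u₁ + 1) x₂)
    (hyG : G.IsResponse (Complex.I * ω) y₂ yG) (hu : CL₁.IsResponse (Complex.I * ω) (-yG) u₁)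
    (hy₂ : CL₂.IsResponse (Complex.I * ω) x₂ y₂) (her : Cs.IsResponse (Complex.I * ω) u₁ er) :
    ∃ ν : ℝ, 0 < ν ∧ nsvUpsilon CR G CL₁ CL₂ ω = ν * x₁.re ∧
      nsvChi CR G CL₁ CL₂ Cs ω = ν * (-er.re) := by
  rw [HasPoleAt, aeval_openLoopDen] at hω
  have hd₁ : aeval (Complex.I * ω) CL₁.den ≠ 0 := fun h => hω (by simp [h])
  have hdR : aeval (Complex.I * ω) CR.den ≠ 0 := fun h => hω (by simp [h])
  have hd₂ : aeval (Complex.I * ω) CL₂.den ≠ 0 := fun h => hω (by simp [h])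
  have hdG : aeval (Complex.I * ω) G.den ≠ 0 := fun h => hω (by simp [h])
  have hds : aeval (Complex.I * ω) Cs.den ≠ 0 := by
    rw [LTI.aeval_den]; exact hCs.det_ne_zero (by simp)
  have h1 := hR.eq_tf hdR
  have h2 := hyG.eq_tf hdG
  have h3 := hu.eq_tf hd₁
  have h4 := hy₂.eq_tf hd₂
  have h5 := her.eq_tf hds
  set L := openLoop CR G CL₁ CL₂ (Complex.I * ω) with hL
  have hLdef : L = CL₁.tf (Complex.I * ω) * CR.tf (Complex.I * ω) * CL₂.tf (Complex.I * ω) *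
    G.tf (Complex.I * ω) := rfl
  have hx₂ : x₂ * (1 + L) = CR.tf (Complex.I * ω) := by
    have : x₂ = CR.tf (Complex.I * ω) * (CL₁.tf (Complex.I * ω) *
        -(G.tf (Complex.I * ω) * (CL₂.tf (Complex.I * ω) * x₂)) + 1) := by
      rw [← h4, ← h2, ← h3, ← h1]
    rw [hLdef]
    linear_combination this
  have hu₁ : u₁ * (1 + L) = -L := by
    have : u₁ = CL₁.tf (Complex.I * ω) * -(G.tf (Complex.I * ω) * (CL₂.tf (Complex.I * ω) * x₂)) := by
      rw [← h4, ← h2, ← h3]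
    linear_combination (1 + L) * this - CL₁.tf (Complex.I * ω) * G.tf (Complex.I * ω) *
      CL₂.tf (Complex.I * ω) * hx₂ + hLdef
  -- If `1 + L` vanished, `u₁ (1 + L) = -L` would give `L = 0`, hence `1 = 0`.
  have h1L : 1 + L ≠ 0 := by
    intro h0
    have hL0 : L = 0 := by rw [h0, mul_zero] at hu₁; simpa using hu₁.symm
    rw [hL0] at h0
    simp at h0
  have hns : (Complex.normSq (1 + L) : ℂ) = (1 + L) * kappa CR G CL₁ CL₂ ω := by
    rw [← Complex.mul_conj, kappa, map_add, map_one]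
  refine ⟨Complex.normSq (1 + L), Complex.normSq_pos.2 h1L, ?_, ?_⟩
  · have e : (Complex.normSq (1 + L) : ℂ) * x₁ =
        Complex.I * (ω * kappa CR G CL₁ CL₂ ω * CR.tf (Complex.I * ω)) := by
      rw [hns, hx]
      linear_combination (kappa CR G CL₁ CL₂ ω) * Complex.I * ω * hx₂
    have := congrArg Complex.re e
    rw [Complex.re_ofReal_mul, Complex.I_mul_re] at this
    rw [this]; rfl
  · have e : (Complex.normSq (1 + L) : ℂ) * (-er) =
        L * kappa CR G CL₁ CL₂ ω * Cs.tf (Complex.I * ω) := by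
      rw [hns, h5]
      linear_combination -(kappa CR G CL₁ CL₂ ω) * Cs.tf (Complex.I * ω) * hu₁
    have := congrArg Complex.re e
    rw [Complex.re_ofReal_mul, Complex.neg_re] at this
    rw [this]; rfl

lemma sosre_den_zero : aeval (0 : ℂ) (sosre ξ ωr γ).toLTI.den = ωr ^ 2 := by
  rw [LTI.aeval_den, Matrix.det_fin_two]
  simp [sosre, toC]

/-- With a pole of the open loop at the origin, the output of the reset element has no constant
component. -/
lemma response_at_pole (hωr : 0 < ωr) (hCs : IsHurwitz Cs.A)
    (hcancel : NoPoleZeroCancellation (sosre ξ ωr γ).toLTI G CL₁ CL₂)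
    (hpole : HasPoleAt (sosre ξ ωr γ).toLTI G CL₁ CL₂ 0) {u₁ yG y₂ x₂ er : ℂ}
    (hx : (ωr : ℂ) ^ 2 * x₂ = u₁ + 1)
    (hyG : G.IsResponse 0 y₂ yG) (hu : CL₁.IsResponse 0 (-yG) u₁)
    (hy₂ : CL₂.IsResponse 0 x₂ y₂) (her : Cs.IsResponse 0 u₁ er) :
    PoleAtOrigin G CL₁ CL₂ ∧ -er.re = filterDC Cs := by
  have hω0 : (ωr : ℂ) ^ 2 ≠ 0 := by
    have : (ωr : ℂ) ≠ 0 := by exact_mod_cast hωr.ne'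
    positivity
  -- The reset element contributes the factor `ωr ^ 2 ≠ 0`, so the pole comes from the other blocks.
  have hden : aeval (0 : ℂ) (CL₁.den * CL₂.den * G.den) = 0 := by
    rw [HasPoleAt, aeval_openLoopDen] at hpole
    simp only [Complex.ofReal_zero, mul_zero, sosre_den_zero] at hpole
    simp only [map_mul]
    have : (ωr : ℂ) ^ 2 * (aeval (0 : ℂ) CL₁.den * aeval (0 : ℂ) CL₂.den * aeval (0 : ℂ) G.den) =
        0 := by linear_combination hpole
    exact (mul_eq_zero.1 this).resolve_left hω0
  have hx₂ : x₂ = 0 := by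
    have h1 := hyG.den_mul
    have h2 := hu.den_mul
    have h3 := hy₂.den_mul
    obtain ⟨p, q, hpq⟩ := hcancel
    have hpq' := congrArg (aeval (0 : ℂ)) hpq
    rw [HasPoleAt] at hpole
    simp only [Complex.ofReal_zero, mul_zero] at hpole
    rw [map_add, map_mul, map_mul, hpole, mul_zero, add_zero, map_one] at hpq'
    have hnum : aeval (0 : ℂ) (CL₁.num * CL₂.num * G.num) ≠ 0 := by
      intro h0
      have : aeval (0 : ℂ) (openLoopNum (sosre ξ ωr γ).toLTI G CL₁ CL₂) =
          aeval (0 : ℂ) (CL₁.num * CL₂.num * G.num) * aeval (0 : ℂ) (sosre ξ ωr γ).toLTI.num := by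
        simp only [openLoopNum, map_mul]; ring
      rw [this, h0, zero_mul, mul_zero] at hpq'
      exact zero_ne_one hpq'
    -- Chaining the three blocks gives `d₁ d₂ d_G u₁ = -n₁ n₂ n_G x₂` for their denominators and
    -- numerators at `0`, and the left side vanishes.
    have hprod : aeval (0 : ℂ) (CL₁.num * CL₂.num * G.num) * x₂ = 0 := by
      simp only [map_mul] at hden ⊢
      linear_combination -(u₁) * hden + aeval (0 : ℂ) CL₂.den * aeval (0 : ℂ) G.den * h2 -
        aeval (0 : ℂ) CL₁.num * aeval (0 : ℂ) CL₂.den * h1 -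
        aeval (0 : ℂ) CL₁.num * aeval (0 : ℂ) G.num * h3
    exact (mul_eq_zero.1 hprod).resolve_left hnum
  have hu₁ : u₁ = -1 := by
    rw [hx₂, mul_zero] at hx
    linear_combination -hx
  have hds : aeval (0 : ℂ) Cs.den ≠ 0 := by
    rw [LTI.aeval_den]; exact hCs.det_ne_zero (by simp)
  refine ⟨?_, ?_⟩
  · have h0 : aeval (0 : ℂ) (CL₁.den * CL₂.den * G.den) =
        (((CL₁.den * CL₂.den * G.den).eval 0 : ℝ) : ℂ) := by
      have := Polynomial.aeval_algebraMap_apply ℂ (0 : ℝ) (CL₁.den * CL₂.den * G.den)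
      simpa using this
    rw [h0] at hden
    exact_mod_cast hden
  · rw [her.eq_tf hds, hu₁, filterDC]
    simp

end Loop

/-! ### The frequency response of the reset state -/

section Response

variable {N : Type*} [Fintype N] [DecidableEq N]

/-- The response `(j ω - A)⁻¹ e` to an excitation of the state with index `i₀`. -/
def stateResponse (A : Matrix N N ℝ) (i₀ : N) (ω : ℝ) : N → ℂ :=
  (Matrix.scalar N (Complex.I * ω) - toC A)⁻¹ *ᵥ Pi.single i₀ 1

variable {A : Matrix N N ℝ}

lemma scalar_sub_mulVec (s : ℂ) (z : N → ℂ) :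
    (Matrix.scalar N s - toC A) *ᵥ z = s • z - toC A *ᵥ z := by
  rw [Matrix.sub_mulVec, Matrix.scalar_apply, ← Matrix.smul_one_eq_diagonal,
    Matrix.smul_mulVec, Matrix.one_mulVec]

lemma stateResponse_eq (hA : IsHurwitz A) (i₀ : N) (ω : ℝ) : (Complex.I * ω) • stateResponse A i₀ ω =
    toC A *ᵥ stateResponse A i₀ ω + Pi.single i₀ 1 := by
  have hdet := hA.det_ne_zero (s := Complex.I * ω) (by simp)
  have : (Matrix.scalar N (Complex.I * ω) - toC A) *ᵥ stateResponse A i₀ ω = Pi.single i₀ 1 := by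
    rw [stateResponse, Matrix.mulVec_mulVec,
      Matrix.mul_nonsing_inv _ (isUnit_iff_ne_zero.2 hdet), Matrix.one_mulVec]
  rw [scalar_sub_mulVec] at this
  rw [← this]; abel

lemma eq_smul_stateResponse (hA : IsHurwitz A) (i₀ : N) {ω : ℝ} {z : N → ℂ} {μ : ℂ}
    (hz : (Complex.I * ω) • z = toC A *ᵥ z + Pi.single i₀ μ) : z = μ • stateResponse A i₀ ω := by
  have hdet := hA.det_ne_zero (s := Complex.I * ω) (by simp)
  have h1 : (Matrix.scalar N (Complex.I * ω) - toC A) *ᵥ z = μ • Pi.single i₀ 1 := by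
    rw [scalar_sub_mulVec, hz, add_sub_cancel_left, ← Pi.single_smul]
    simp
  have h2 := congrArg ((Matrix.scalar N (Complex.I * ω) - toC A)⁻¹ *ᵥ ·) h1
  simp only [Matrix.mulVec_mulVec, Matrix.nonsing_inv_mul _ (isUnit_iff_ne_zero.2 hdet),
    Matrix.one_mulVec, Matrix.mulVec_smul] at h2
  exact h2

/-- `A` and the excitation are real, so the conjugate solves the equation at `-ω`. Positivity of
real parts therefore needs checking only for `ω ≥ 0`. -/
lemma stateResponse_neg (hA : IsHurwitz A) (i₀ : N) (ω : ℝ) (i : N) :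
    stateResponse A i₀ (-ω) i = star (stateResponse A i₀ ω i) := by
  have h : (Complex.I * ((-ω : ℝ) : ℂ)) • star (stateResponse A i₀ ω) =
      toC A *ᵥ star (stateResponse A i₀ ω) + Pi.single i₀ 1 := by
    ext i
    have := congrArg star (congrFun (stateResponse_eq hA i₀ ω) i)
    have hs : star ((Pi.single i₀ 1 : N → ℂ) i) = (Pi.single i₀ 1 : N → ℂ) i := by
      by_cases hi : i = i₀
      · subst hi; simp
      · simp [hi]
    rw [Pi.add_apply, star_add, hs] at this
    rw [Pi.add_apply]
    convert this using 1
    · simp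
    · congr 1
      simp [Matrix.mulVec, dotProduct]
  have := eq_smul_stateResponse hA i₀ h
  rw [one_smul] at this
  rw [← this]; rfl

lemma continuous_stateResponse (hA : IsHurwitz A) (i₀ : N) : Continuous (stateResponse A i₀) := by
  have hM : Continuous fun ω : ℝ => Matrix.scalar N (Complex.I * (ω : ℂ)) - toC A := by
    simp only [Matrix.scalar_apply]
    fun_prop
  have hinv : Continuous fun ω : ℝ => (Matrix.scalar N (Complex.I * (ω : ℂ)) - toC A)⁻¹ := by
    simp only [Matrix.inv_def, Ring.inverse_eq_inv']
    exact (hM.matrix_det.inv₀ fun ω => hA.det_ne_zero (by simp)).smul hM.matrix_adjugate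
  exact hinv.matrix_mulVec continuous_const

open scoped Matrix.Norms.Operator in
-- The defining equation gives `ω ‖X‖ ≤ ‖A‖ ‖X‖ + 1`.
lemma tendsto_stateResponse (hA : IsHurwitz A) (i₀ : N) : Tendsto (stateResponse A i₀) atTop (𝓝 0) := by
  set K := ‖toC A‖ with hK
  have hsingle : ‖(Pi.single i₀ 1 : N → ℂ)‖ ≤ 1 := by
    rw [pi_norm_le_iff_of_nonneg zero_le_one]
    intro i
    by_cases hi : i = i₀
    · subst hi; simp
    · simp [hi]
  rw [tendsto_zero_iff_norm_tendsto_zero]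
  have hlim : Tendsto (fun ω : ℝ => (ω - K)⁻¹) atTop (𝓝 0) :=
    tendsto_inv_atTop_zero.comp (tendsto_atTop_add_const_right _ (-K) tendsto_id)
  refine squeeze_zero' (Eventually.of_forall fun _ => norm_nonneg _) ?_ hlim
  filter_upwards [eventually_gt_atTop (max K 0)] with ω hω
  have hωK : 0 < ω - K := sub_pos.2 ((le_max_left _ _).trans_lt hω)
  have hω0 : 0 < ω := (le_max_right _ _).trans_lt hω
  have h1 := congrArg norm (stateResponse_eq hA i₀ ω)
  rw [norm_smul, norm_mul, Complex.norm_I, one_mul, Complex.norm_real, Real.norm_of_nonneg hω0.le]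
    at h1
  have h2 : ω * ‖stateResponse A i₀ ω‖ ≤ K * ‖stateResponse A i₀ ω‖ + 1 := by
    rw [h1]
    exact (norm_add_le _ _).trans (add_le_add (Matrix.linfty_opNorm_mulVec _ _) hsingle)
  rw [inv_eq_one_div, le_div_iff₀ hωK]
  linarith

/-- The real part of the transfer function from the excited state to `c`, weighted by
`1 + ω ^ 2`. -/
def weightedRe (A : Matrix N N ℝ) (i₀ : N) (c : N → ℝ) (ω : ℝ) : ℝ :=
  (1 + ω ^ 2) * (∑ i, (c i : ℂ) * stateResponse A i₀ ω i).re

lemma continuous_weightedRe (hA : IsHurwitz A) (i₀ : N) (c : N → ℝ) : Continuous (weightedRe A i₀ c) := by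
  have h := continuous_stateResponse hA i₀
  unfold weightedRe
  refine (by fun_prop : Continuous fun ω : ℝ => 1 + ω ^ 2).mul (Complex.continuous_re.comp ?_)
  exact continuous_finsetSum _ fun i _ => continuous_const.mul ((continuous_apply i).comp h)

/-- Substituting `jω X = A X + e` into itself expresses `ω ^ 2 c ⬝ᵥ X` as an imaginary term, the
constant `-c ⬝ᵥ A e` and a vanishing remainder. The weight thus gives the real part a finite limit,
so behaviour at infinity can be compared by limits. -/
lemma tendsto_weightedRe (hA : IsHurwitz A) (i₀ : N) (c : N → ℝ) : Tendsto (weightedRe A i₀ c) atTop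
    (𝓝 (-(c ⬝ᵥ (A *ᵥ Pi.single i₀ 1)))) := by
  set cC : N → ℂ := fun i => (c i : ℂ) with hcC
  set X := stateResponse A i₀ with hX
  have hexp : ∀ ω : ℝ, weightedRe A i₀ c ω = (cC ⬝ᵥ X ω).re -
      c ⬝ᵥ (A *ᵥ Pi.single i₀ 1) - (cC ⬝ᵥ (toC A *ᵥ (toC A *ᵥ X ω))).re := by
    intro ω
    have e0 := stateResponse_eq hA i₀ ω
    have e1 := congrArg (cC ⬝ᵥ ·) e0
    have e2 := congrArg (fun y => cC ⬝ᵥ (toC A *ᵥ y)) e0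
    simp only [dotProduct_smul, Matrix.mulVec_smul, Matrix.mulVec_add, dotProduct_add,
      smul_eq_mul] at e1 e2
    have hb : cC ⬝ᵥ Pi.single i₀ 1 = (c i₀ : ℂ) := by simp [hcC]
    have hAb : cC ⬝ᵥ (toC A *ᵥ Pi.single i₀ 1) = ((c ⬝ᵥ (A *ᵥ Pi.single i₀ 1) : ℝ) : ℂ) := by
      simp [hcC, dotProduct, Matrix.mulVec_single]
    rw [hb] at e1
    rw [hAb] at e2
    have e3 : (ω : ℂ) ^ 2 * (cC ⬝ᵥ X ω) = -(Complex.I * ω) * c i₀ -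
        ((c ⬝ᵥ (A *ᵥ Pi.single i₀ 1) : ℝ) : ℂ) - cC ⬝ᵥ (toC A *ᵥ (toC A *ᵥ X ω)) := by
      have hI := Complex.I_mul_I
      linear_combination -(Complex.I * ω) * e1 - e2 + (ω : ℂ) ^ 2 * (cC ⬝ᵥ X ω) * hI
    have e4 := congrArg Complex.re e3
    rw [show (ω : ℂ) ^ 2 = ((ω ^ 2 : ℝ) : ℂ) by push_cast; rfl, Complex.re_ofReal_mul] at e4
    have e5 : (-(Complex.I * (ω : ℂ)) * c i₀).re = 0 := by simp
    rw [Complex.sub_re, Complex.sub_re, e5, Complex.ofReal_re] at e4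
    have e6 : weightedRe A i₀ c ω = (1 + ω ^ 2) * (cC ⬝ᵥ X ω).re := rfl
    rw [e6]
    linarith
  have h0 := tendsto_stateResponse hA i₀
  have hc1 : Continuous fun y : N → ℂ => (cC ⬝ᵥ y).re := by fun_prop
  have hc2 : Continuous fun y : N → ℂ => (cC ⬝ᵥ (toC A *ᵥ (toC A *ᵥ y))).re := by fun_prop
  have h1 := (hc1.tendsto 0).comp h0
  have h2 := (hc2.tendsto 0).comp h0
  have h3 := (h1.sub_const (c ⬝ᵥ (A *ᵥ Pi.single i₀ 1))).sub h2
  simp only [dotProduct_zero, Matrix.mulVec_zero, Complex.zero_re, zero_sub, sub_zero] at h3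
  exact h3.congr fun ω => (hexp ω).symm

end Response

/-! ### The choice of the multiplier -/

/-- On the compact set where `f₂ ≤ 0`, `f₁` has a positive minimum, which dominates `β f₂` for small
`β`; elsewhere both terms have the right sign. -/
lemma exists_small_multiplier {f₁ f₂ : ℝ → ℝ} {K : Set ℝ} (hK : IsCompact K)
    (h₁ : ContinuousOn f₁ K) (h₂ : ContinuousOn f₂ K) (hnn : ∀ ω ∈ K, 0 ≤ f₁ ω)
    (hpos : ∀ ω ∈ K, f₁ ω = 0 → 0 < f₂ ω) :
    ∃ δ : ℝ, 0 < δ ∧ ∀ β, 0 < β → β ≤ δ → ∀ ω ∈ K, 0 < f₁ ω + β * f₂ ω := by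
  obtain ⟨B, hB⟩ := hK.exists_bound_of_continuousOn h₂
  have hB' : ∀ ω ∈ K, |f₂ ω| ≤ |B| := fun ω hω => (hB ω hω).trans (le_abs_self B)
  have hK' : IsCompact (K ∩ f₂ ⁻¹' Set.Iic 0) := by
    obtain ⟨C, hC, hCe⟩ := continuousOn_iff_isClosed.1 h₂ _ isClosed_Iic
    rw [Set.inter_comm, hCe, Set.inter_comm]
    exact hK.inter_right hC
  obtain ⟨m, hm, hmb⟩ : ∃ m : ℝ, 0 < m ∧ ∀ ω ∈ K, f₂ ω ≤ 0 → m ≤ f₁ ω := by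
    rcases (K ∩ f₂ ⁻¹' Set.Iic 0).eq_empty_or_nonempty with he | hne
    · exact ⟨1, one_pos, fun ω hω h => absurd (show ω ∈ K ∩ f₂ ⁻¹' Set.Iic 0 from ⟨hω, h⟩)
        (by simp [he])⟩
    · obtain ⟨y, hy, hmin⟩ := hK'.exists_isMinOn hne (h₁.mono Set.inter_subset_left)
      refine ⟨f₁ y, ?_, fun ω hω h => hmin ⟨hω, h⟩⟩
      refine lt_of_le_of_ne (hnn y hy.1) fun h => ?_
      exact absurd (hpos y hy.1 h.symm) (not_lt.2 hy.2)
  refine ⟨m / (|B| + 1), by positivity, fun β hβ hβδ ω hω => ?_⟩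
  rcases lt_or_ge 0 (f₂ ω) with h | h
  · have := hnn ω hω
    positivity
  · have h1 := hmb ω hω h
    have h2 : -|B| ≤ f₂ ω := (abs_le.1 (hB' ω hω)).1
    have h3 : β * (|B| + 1) ≤ m := by rwa [le_div_iff₀ (by positivity)] at hβδ
    nlinarith [mul_le_mul_of_nonneg_left h2 hβ.le]

/-- Beyond some `T` one has `f₁ > l / 2` and `f₂ > -1`, so `[0, T]` decides. A small `β` works if
`f₁ ≥ 0`, a large one if `f₂ ≥ 0`. -/
lemma exists_multiplier {f₁ f₂ : ℝ → ℝ} {l : ℝ} (h₁ : Continuous f₁) (h₂ : Continuous f₂)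
    (hl : 0 < l) (ht₁ : Tendsto f₁ atTop (𝓝 l)) (ht₂ : Tendsto f₂ atTop (𝓝 0))
    (hz₂ : ∀ ω, 0 ≤ ω → f₂ ω = 0 → 0 < f₁ ω) (hz₁ : ∀ ω, 0 ≤ ω → f₁ ω = 0 → 0 < f₂ ω)
    (h : (∀ ω, 0 ≤ ω → 0 ≤ f₁ ω) ∨ (∀ ω, 0 ≤ ω → 0 ≤ f₂ ω) ∨
      ∃ β : ℝ, ∀ ω, 0 ≤ ω → 0 < f₁ ω + β * f₂ ω) :
    ∃ β : ℝ, ∀ ω, 0 ≤ ω → 0 < f₁ ω + β * f₂ ω := by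
  obtain ⟨T, hT⟩ := eventually_atTop.1
    ((ht₁.eventually_const_lt (half_lt_self hl)).and (ht₂.eventually_const_lt neg_one_lt_zero))
  have hcases : ∀ ω : ℝ, 0 ≤ ω → ω ∈ Set.Icc 0 T ∨ T ≤ ω := fun ω hω =>
    (le_total ω T).imp (fun h => ⟨hω, h⟩) id
  rcases h with h | h | h
  · obtain ⟨δ, hδ, hb⟩ := exists_small_multiplier isCompact_Icc (K := Set.Icc 0 T)
      h₁.continuousOn h₂.continuousOn (fun ω hω => h ω hω.1) fun ω hω => hz₁ ω hω.1
    have hβ : 0 < min δ (l / 2) := lt_min hδ (by positivity)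
    refine ⟨min δ (l / 2), fun ω hω => ?_⟩
    rcases hcases ω hω with hc | hc
    · exact hb _ hβ (min_le_left _ _) ω hc
    · obtain ⟨h1, h2⟩ := hT ω hc
      nlinarith [min_le_right δ (l / 2)]
  · obtain ⟨δ, hδ, hb⟩ := exists_small_multiplier isCompact_Icc (K := Set.Icc 0 T)
      h₂.continuousOn h₁.continuousOn (fun ω hω => h ω hω.1) fun ω hω => hz₂ ω hω.1
    refine ⟨δ⁻¹, fun ω hω => ?_⟩
    rcases hcases ω hω with hc | hc
    · have h1 := hb δ hδ le_rfl ω hc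
      have h2 : f₁ ω + δ⁻¹ * f₂ ω = δ⁻¹ * (f₂ ω + δ * f₁ ω) := by field_simp; ring
      rw [h2]; positivity
    · obtain ⟨h1, h2⟩ := hT ω hc
      have := h ω hω
      have : 0 < f₁ ω := by linarith
      positivity
  · exact h

section Types

variable {Ω : Set ℝ} {Nχ NΥ : ℝ → ℝ} {pole : Prop} {Ks₀ : ℝ}

/-- Reflection in the vertical axis exchanges the first quadrant with the second and the third with
the fourth, and preserves `|NΥ / Nχ|`. -/
lemma IsTypeII.isTypeI_neg (h : IsTypeII Ω Nχ NΥ pole Ks₀) :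
    IsTypeI Ω (fun ω => -Nχ ω) NΥ pole (-Ks₀) := by
  obtain ⟨h1, h2, h3, h4⟩ := h
  refine ⟨fun hp => neg_pos.2 (h1 hp), fun ω hω h0 => h2 ω hω (neg_eq_zero.1 h0),
    fun ω hω h0 => neg_pos.2 (h3 ω hω h0), ?_⟩
  refine h4.imp id (Or.imp (fun h ω hω => neg_nonneg.2 (h ω hω)) fun h => ?_)
  simpa [quad₁, quad₂, quad₃, quad₄, slopeSup, slopeInf, div_neg, abs_neg] using h

/-- A multiplier from the separation of the slopes in the second and fourth quadrants. -/
lemma exists_multiplier_of_slopes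
    (hχ : ∀ ω ∈ Ω, Nχ ω = 0 → 0 < NΥ ω) (hΥ : ∀ ω ∈ Ω, NΥ ω = 0 → 0 < Nχ ω)
    (hlt : slopeSup (quad₄ Ω Nχ NΥ) Nχ NΥ < slopeInf (quad₂ Ω Nχ NΥ) Nχ NΥ)
    (h3 : quad₃ Ω Nχ NΥ = ∅) : ∃ β : ℝ, 0 < β ∧ ∀ ω ∈ Ω, 0 < NΥ ω + β * Nχ ω := by
  -- Any number strictly between the two slopes serves as multiplier; it is positive because the
  -- supremum is at least `0`.
  obtain ⟨b, hb1, hb2⟩ := ENNReal.lt_iff_exists_nnreal_btwn.1 hlt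
  have hb0 : 0 < (b : ℝ) := by
    have : (0 : ENNReal) < b := bot_le.trans_lt hb1
    exact_mod_cast this
  refine ⟨b, hb0, fun ω hω => ?_⟩
  rcases lt_trichotomy (Nχ ω) 0 with hc | hc | hc <;> rcases lt_trichotomy (NΥ ω) 0 with hy | hy | hy
  · have : ω ∈ quad₃ Ω Nχ NΥ := ⟨hω, hc, hy⟩
    rw [h3] at this; exact this.elim
  · linarith [hΥ ω hω hy]
  · have h1 : (b : ENNReal) < ENNReal.ofReal |NΥ ω / Nχ ω| :=
      hb2.trans_le (iInf₂_le (f := fun ω _ => ENNReal.ofReal |NΥ ω / Nχ ω|) ω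
        (show ω ∈ quad₂ Ω Nχ NΥ from ⟨hω, hc, hy⟩))
    rw [← ENNReal.ofReal_coe_nnreal, ENNReal.ofReal_lt_ofReal_iff_of_nonneg b.coe_nonneg, abs_div,
      abs_of_pos hy, abs_of_neg hc, lt_div_iff₀ (by linarith)] at h1
    linarith
  · linarith [hχ ω hω hc]
  · linarith [hχ ω hω hc]
  · rw [hc]; simpa using hy
  · have h1 : ENNReal.ofReal |NΥ ω / Nχ ω| < (b : ENNReal) :=
      (le_iSup₂ (f := fun ω _ => ENNReal.ofReal |NΥ ω / Nχ ω|) ω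
        (show ω ∈ quad₄ Ω Nχ NΥ from ⟨hω, hc, hy⟩)).trans_lt hb1
    rw [← ENNReal.ofReal_coe_nnreal, ENNReal.ofReal_lt_ofReal_iff hb0, abs_div,
      abs_of_neg hy, abs_of_pos hc, div_lt_iff₀ hc] at h1
    linarith
  · rw [hy]; positivity
  · positivity

/-- For a system of Type I there is a multiplier that makes the combined real part positive at
all frequencies. The functions `f₁`, `f₂` are positive multiples of the components of the Nyquist
stability vector on `Ω`. -/
lemma IsTypeI.exists_multiplier (h : IsTypeI Ω Nχ NΥ pole Ks₀) {f₁ f₂ : ℝ → ℝ} {l : ℝ}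
    (h₁ : Continuous f₁) (h₂ : Continuous f₂) (hl : 0 < l) (ht₁ : Tendsto f₁ atTop (𝓝 l))
    (ht₂ : Tendsto f₂ atTop (𝓝 0))
    (hscale : ∀ ω ∈ Ω, ∃ ν : ℝ, 0 < ν ∧ NΥ ω = ν * f₁ ω ∧ Nχ ω = ν * f₂ ω)
    (hpole : ∀ ω, 0 ≤ ω → ω ∉ Ω → pole ∧ f₁ ω = 0 ∧ f₂ ω = Ks₀) :
    ∃ β : ℝ, ∀ ω, 0 ≤ ω → 0 < f₁ ω + β * f₂ ω := by
  obtain ⟨hp, hχ, hΥ, hq⟩ := h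
  have hout : ∀ ω, 0 ≤ ω → ω ∉ Ω → f₁ ω = 0 ∧ 0 < f₂ ω := fun ω hω hn => by
    obtain ⟨h1, h2, h3⟩ := hpole ω hω hn
    exact ⟨h2, h3 ▸ hp h1⟩
  refine ResetControl.exists_multiplier h₁ h₂ hl ht₁ ht₂ (fun ω hω h0 => ?_) (fun ω hω h0 => ?_) ?_
  · by_cases hm : ω ∈ Ω
    · obtain ⟨ν, hν, e1, e2⟩ := hscale ω hm
      have := hχ ω hm (by rw [e2, h0, mul_zero])
      rw [e1] at this
      exact (pos_iff_pos_of_mul_pos this).1 hν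
    · exact absurd h0 (hout ω hω hm).2.ne'
  · by_cases hm : ω ∈ Ω
    · obtain ⟨ν, hν, e1, e2⟩ := hscale ω hm
      have := hΥ ω hm (by rw [e1, h0, mul_zero])
      rw [e2] at this
      exact (pos_iff_pos_of_mul_pos this).1 hν
    · exact (hout ω hω hm).2
  · rcases hq with hq | hq | ⟨hlt, h3⟩
    · refine Or.inl fun ω hω => ?_
      by_cases hm : ω ∈ Ω
      · obtain ⟨ν, hν, e1, e2⟩ := hscale ω hm
        have := hq ω hm
        rw [e1] at this
        exact nonneg_of_mul_nonneg_right this hν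
      · exact (hout ω hω hm).1.ge
    · refine Or.inr (Or.inl fun ω hω => ?_)
      by_cases hm : ω ∈ Ω
      · obtain ⟨ν, hν, e1, e2⟩ := hscale ω hm
        have := hq ω hm
        rw [e2] at this
        exact nonneg_of_mul_nonneg_right this hν
      · exact (hout ω hω hm).2.le
    · obtain ⟨β, hβ, hb⟩ := exists_multiplier_of_slopes hχ hΥ hlt h3
      refine Or.inr (Or.inr ⟨β, fun ω hω => ?_⟩)
      by_cases hm : ω ∈ Ω
      · obtain ⟨ν, hν, e1, e2⟩ := hscale ω hm
        have := hb ω hm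
        rw [e1, e2, show ν * f₁ ω + β * (ν * f₂ ω) = ν * (f₁ ω + β * f₂ ω) by ring] at this
        exact (pos_iff_pos_of_mul_pos this).1 hν
      -- At the pole the combination reduces to `β f₂`, so positivity of `β` is needed.
      · rw [(hout ω hω hm).1, zero_add]
        exact mul_pos hβ (hout ω hω hm).2

end Types

/-! ### Stability of the loop -/

section Main

variable {ιG ι₁ ι₂ ιs : Type*} [Fintype ιG] [DecidableEq ιG] [Fintype ι₁] [DecidableEq ι₁]
  [Fintype ι₂] [DecidableEq ι₂] [Fintype ιs] [DecidableEq ιs]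
  {G : LTI ιG} {CL₁ : LTI ι₁} {CL₂ : LTI ι₂} {Cs : LTI ιs} {ξ ωr γ : ℝ}

/-- `Ce` vanishes on the states of the reset element, so this is `-2 ξ ωr` for `c = e + β • Ce` and
`0` for `c = Ce`: the condition at infinite frequency holds for every `β`. -/
lemma dotProduct_closedLoop_column
    (c : Fin 2 ⊕ (ιG ⊕ ι₁ ⊕ ι₂ ⊕ ιs) → ℝ) :
    c ⬝ᵥ ((closedLoop (sosre ξ ωr γ) (linearPart G CL₁ CL₂ Cs)).A *ᵥ Pi.single (.inl 0) 1) =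
      c (.inl 0) * -(2 * ξ * ωr) + c (.inl 1) := by
  have h : ∀ i, ((closedLoop (sosre ξ ωr γ) (linearPart G CL₁ CL₂ Cs)).A *ᵥ
      Pi.single (.inl 0) 1) i = (closedLoop (sosre ξ ωr γ) (linearPart G CL₁ CL₂ Cs)).A i
        (.inl 0) := fun i => by simp
  rw [dotProduct, Fintype.sum_sum_type, Fin.sum_univ_two]
  simp only [h, closedLoop_A_inl_inl, closedLoop_A_inr_inl]
  simp [sosre]

lemma closedLoop_reset {n : Type*} [Fintype n] [DecidableEq n] (P : LinearPart n)
    (x : Fin 2 ⊕ n → ℝ) :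
    (closedLoop (sosre ξ ωr γ) P).Aρ *ᵥ x = x + Pi.single (.inl 0) ((γ - 1) * x (.inl 0)) := by
  change Matrix.fromBlocks !![γ, 0; 0, 1] 0 0 1 *ᵥ x = _
  rw [Matrix.fromBlocks_mulVec]
  ext i
  rcases i with i | i
  · fin_cases i
    · simp [dotProduct, Fin.sum_univ_two]; ring
    · simp [dotProduct, Fin.sum_univ_two]
  · simp

/-- Under the Type I or Type II condition some combination of the reset state and the triggering
signal has a positive real transfer function. -/
lemma exists_positive_real (hG : G.d = 0) (hCs : IsHurwitz Cs.A) (hξ : 0 < ξ) (hωr : 0 < ωr)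
    (hstable : IsHurwitz (closedLoop (sosre ξ ωr γ) (linearPart G CL₁ CL₂ Cs)).A)
    (hcancel : NoPoleZeroCancellation (sosre ξ ωr γ).toLTI G CL₁ CL₂)
    (hpole : ∀ ω : ℝ, 0 < ω → ¬ HasPoleAt (sosre ξ ωr γ).toLTI G CL₁ CL₂ ω)
    {σ : ℝ} (htype : IsTypeI (freqs (sosre ξ ωr γ).toLTI G CL₁ CL₂)
        (fun ω => σ * nsvChi (sosre ξ ωr γ).toLTI G CL₁ CL₂ Cs ω)
        (nsvUpsilon (sosre ξ ωr γ).toLTI G CL₁ CL₂) (PoleAtOrigin G CL₁ CL₂) (σ * filterDC Cs)) :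
    ∃ β : ℝ, ∀ ω : ℝ, 0 ≤ ω →
      0 < (∑ i, (((Pi.single (.inl 0) 1 + β •
        (closedLoop (sosre ξ ωr γ) (linearPart G CL₁ CL₂ Cs)).Ce :
          Fin 2 ⊕ (ιG ⊕ ι₁ ⊕ ι₂ ⊕ ιs) → ℝ) i : ℝ) : ℂ) *
        stateResponse (closedLoop (sosre ξ ωr γ) (linearPart G CL₁ CL₂ Cs)).A
          (.inl 0) ω i).re := by
  set S := closedLoop (sosre ξ ωr γ) (linearPart G CL₁ CL₂ Cs) with hS
  set X := stateResponse S.A (.inl 0) with hX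
  set h₁ : ℝ → ℝ := fun ω => (X ω (.inl 0)).re with hh₁
  set h₂ : ℝ → ℝ := fun ω => -(∑ i, (S.Ce i : ℂ) * X ω i).re with hh₂
  set f₁ := weightedRe S.A (.inl 0) (Pi.single (.inl 0) 1) with hf₁
  set f₂ : ℝ → ℝ := fun ω => -σ * weightedRe S.A (.inl 0) S.Ce ω with hf₂
  have e₁ : ∀ ω, f₁ ω = (1 + ω ^ 2) * h₁ ω := by
    intro ω
    simp only [hf₁, weightedRe, hh₁]
    congr 2
    rw [Finset.sum_eq_single (.inl 0)]
    · simp [hX]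
    · intro i _ hi; simp [hi]
    · simp
  have e₂ : ∀ ω, f₂ ω = σ * ((1 + ω ^ 2) * h₂ ω) := by
    intro ω
    simp only [hf₂, weightedRe, hh₂]; ring
  have ht₁ : Tendsto f₁ atTop (𝓝 (2 * ξ * ωr)) := by
    have := tendsto_weightedRe hstable (.inl 0) (Pi.single (.inl 0) 1)
    rw [hS, dotProduct_closedLoop_column] at this
    simpa using this
  have ht₂ : Tendsto f₂ atTop (𝓝 0) := by
    have := (tendsto_weightedRe hstable (.inl 0) S.Ce).const_mul (-σ)
    have h0 : S.Ce ⬝ᵥ (S.A *ᵥ Pi.single (.inl 0) 1) = 0 := by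
      rw [hS, dotProduct_closedLoop_column]
      simp [closedLoop]
    rwa [h0, neg_zero, mul_zero] at this
  have hfreqs : ∀ ω, 0 ≤ ω → ω ∉ freqs (sosre ξ ωr γ).toLTI G CL₁ CL₂ →
      ω = 0 ∧ HasPoleAt (sosre ξ ωr γ).toLTI G CL₁ CL₂ ω := by
    intro ω hω hn
    have hp : HasPoleAt (sosre ξ ωr γ).toLTI G CL₁ CL₂ ω := by
      by_contra h; exact hn ⟨hω, h⟩
    refine ⟨?_, hp⟩
    by_contra h0
    exact hpole ω (lt_of_le_of_ne hω (Ne.symm h0)) hp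
  obtain ⟨β, hβ⟩ := htype.exists_multiplier (continuous_weightedRe hstable _ _)
    ((continuous_weightedRe hstable _ _).const_mul (-σ)) (by positivity) ht₁ ht₂
    (fun ω hω => by
      obtain ⟨u₁, yG, y₂, hx, -, hR, hyG, hu, hy₂, her⟩ :=
        responses_of_closedLoop hG (stateResponse_eq hstable (.inl 0) ω)
      obtain ⟨ν, hν, hν₁, hν₂⟩ := nsv_of_response hω.2 hCs hx hR hyG hu hy₂ her
      refine ⟨ν / (1 + ω ^ 2), by positivity, ?_, ?_⟩
      · change _ = _ * f₁ ω
        rw [hν₁, e₁]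
        field_simp
        rfl
      · change σ * _ = _ * f₂ ω
        have hh : nsvChi (sosre ξ ωr γ).toLTI G CL₁ CL₂ Cs ω = ν * h₂ ω := hν₂
        rw [hh, e₂]
        field_simp)
    (fun ω hω hn => by
      obtain ⟨rfl, hp⟩ := hfreqs ω hω hn
      obtain ⟨u₁, yG, y₂, hx, hx₂, hR, hyG, hu, hy₂, her⟩ :=
        responses_of_closedLoop hG (stateResponse_eq hstable (.inl 0) 0)
      rw [Complex.ofReal_zero, mul_zero] at hx hx₂ hyG hu hy₂ her
      rw [zero_mul] at hx
      rw [hx, mul_zero, sub_zero] at hx₂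
      obtain ⟨h1, h2⟩ := response_at_pole hωr hCs hcancel hp hx₂ hyG hu hy₂ her
      refine ⟨h1, ?_, ?_⟩
      · change f₁ 0 = 0
        rw [e₁]
        simp only [hh₁]
        rw [show X 0 (.inl 0) = 0 from hx]; simp
      · change f₂ 0 = _
        rw [e₂, ← h2]
        simp [hh₂, hX, hS])
  -- `f₂` carries both the factor `σ` and the minus sign in `Nχ ~ -Re e_r`, whence the sign of the
  -- coefficient of `Ce`.
  refine ⟨-(β * σ), fun ω hω => ?_⟩
  have hpos : 0 < f₁ ω + β * f₂ ω := hβ ω hω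
  rw [e₁, e₂, show (1 + ω ^ 2) * h₁ ω + β * (σ * ((1 + ω ^ 2) * h₂ ω)) =
    (1 + ω ^ 2) * (h₁ ω + β * σ * h₂ ω) by ring] at hpos
  have hpos' := (pos_iff_pos_of_mul_pos hpos).1 (by positivity)
  have e : (∑ i, (((Pi.single (.inl 0) 1 + (-(β * σ)) • S.Ce :
      Fin 2 ⊕ (ιG ⊕ ι₁ ⊕ ι₂ ⊕ ιs) → ℝ) i : ℝ) : ℂ) * X ω i) =
      X ω (.inl 0) + ((-(β * σ) : ℝ) : ℂ) * ∑ i, (S.Ce i : ℂ) * X ω i := by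
    rw [Finset.mul_sum]
    have : X ω (.inl 0) = ∑ i, (((Pi.single (.inl 0) 1 : Fin 2 ⊕ (ιG ⊕ ι₁ ⊕ ι₂ ⊕ ιs) → ℝ) i : ℝ) :
        ℂ) * X ω i := by
      rw [Finset.sum_eq_single (.inl 0)]
      · simp
      · intro i _ hi; simp [hi]
      · simp
    rw [this, ← Finset.sum_add_distrib]
    refine Finset.sum_congr rfl fun i _ => ?_
    rw [Pi.add_apply, Pi.smul_apply, smul_eq_mul, Complex.ofReal_add, Complex.ofReal_mul]
    ring
  rw [e, Complex.add_re, Complex.re_ofReal_mul]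
  simp only [hh₁, hh₂] at hpos'
  linarith

/-- Conjugate symmetry extends positivity to all real frequencies. Every solution of the frequency
equation is `μ` times the state response, which multiplies the real part by `|μ| ^ 2`, so the
positive real lemma applies. -/
lemma exists_certificate (hγ₁ : -1 < γ) (hγ₂ : γ < 1) (hξ : 0 < ξ) (hωr : 0 < ωr)
    (hstable : IsHurwitz (closedLoop (sosre ξ ωr γ) (linearPart G CL₁ CL₂ Cs)).A) {β : ℝ}
    (hβ : ∀ ω : ℝ, 0 ≤ ω →
      0 < (∑ i, (((Pi.single (.inl 0) 1 + β •
        (closedLoop (sosre ξ ωr γ) (linearPart G CL₁ CL₂ Cs)).Ce :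
          Fin 2 ⊕ (ιG ⊕ ι₁ ⊕ ι₂ ⊕ ιs) → ℝ) i : ℝ) : ℂ) *
        stateResponse (closedLoop (sosre ξ ωr γ) (linearPart G CL₁ CL₂ Cs)).A
          (.inl 0) ω i).re) :
    ∃ P, (closedLoop (sosre ξ ωr γ) (linearPart G CL₁ CL₂ Cs)).Certificate (.inl 0) γ β P := by
  set S := closedLoop (sosre ξ ωr γ) (linearPart G CL₁ CL₂ Cs) with hS
  set c : Fin 2 ⊕ (ιG ⊕ ι₁ ⊕ ι₂ ⊕ ιs) → ℝ := Pi.single (.inl 0) 1 + β • S.Ce with hc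
  have hall : ∀ ω : ℝ, 0 < (∑ i, (c i : ℂ) * stateResponse S.A (.inl 0) ω i).re := by
    intro ω
    rcases le_total 0 ω with h | h
    · exact hβ ω h
    · have h1 := hβ (-ω) (neg_nonneg.2 h)
      have h2 : ∑ i, (c i : ℂ) * stateResponse S.A (.inl 0) (-ω) i =
          star (∑ i, (c i : ℂ) * stateResponse S.A (.inl 0) ω i) := by
        rw [star_sum]
        refine Finset.sum_congr rfl fun i _ => ?_
        rw [stateResponse_neg hstable, star_mul', Complex.star_def, Complex.conj_ofReal]
      rw [h2] at h1
      exact h1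
  obtain ⟨P, hs, hcol, hneg⟩ := exists_lyapunov_of_strictly_positive_real (A := S.A)
      (i₀ := .inl 0) (c := c) (by
    rw [hS, dotProduct_closedLoop_column]
    simp [hc, hS, closedLoop]
    positivity) (fun ω z μ hz hz0 => by
    have hzX := eq_smul_stateResponse hstable (.inl 0) hz
    have hμ : μ ≠ 0 := by
      rintro rfl; exact hz0 (by rw [hzX, zero_smul])
    have e : star μ * ∑ i, (c i : ℂ) * z i =
        (Complex.normSq μ : ℂ) * ∑ i, (c i : ℂ) * stateResponse S.A (.inl 0) ω i := by
      rw [hzX, Complex.normSq_eq_conj_mul_self, Complex.star_def, mul_assoc]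
      congr 1
      rw [Finset.mul_sum]
      refine Finset.sum_congr rfl fun i _ => ?_
      rw [Pi.smul_apply, smul_eq_mul]; ring
    rw [e, Complex.re_ofReal_mul]
    exact mul_pos (Complex.normSq_pos.2 hμ) (hall ω))
  exact ⟨P, abs_lt.2 ⟨hγ₁, hγ₂⟩, closedLoop_reset _, hs, hcol, rfl,
    fun x hx => hstable.lyapunov_pos hs hneg hx, hneg⟩

end Main

end ResetControl

end

theorem corollary4
    {ιG ι₁ ι₂ ιs : Type*} [Fintype ιG] [DecidableEq ιG] [Fintype ι₁] [DecidableEq ι₁]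
    [Fintype ι₂] [DecidableEq ι₂] [Fintype ιs] [DecidableEq ιs]
    -- plant, linear controllers, shaping filter
    (G : ResetControl.LTI ιG) (CL₁ : ResetControl.LTI ι₁) (CL₂ : ResetControl.LTI ι₂)
    (Cs : ResetControl.LTI ιs)
    (hG : G.d = 0) (hCs : ResetControl.IsHurwitz Cs.A)
    -- reset element
    (ξ ωr γ : ℝ) (hξ : 0 < ξ) (hωr : 0 < ωr) (hγ₁ : -1 < γ) (hγ₂ : γ < 1)
    (CR : ResetControl.LTI (Fin 2)) (hCR : CR = (ResetControl.sosre ξ ωr γ).toLTI)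
    -- closed loop
    (S : ResetControl.ResetSystem (Fin 2 ⊕ (ιG ⊕ ι₁ ⊕ ι₂ ⊕ ιs)))
    (hS : S = ResetControl.closedLoop (ResetControl.sosre ξ ωr γ)
      (ResetControl.linearPart G CL₁ CL₂ Cs))
    -- class of Bohl inputs for which the reset instants are well posed
    (𝒲 : Set (ℝ → Fin 2 → ℝ)) (h𝒲 : ∀ w ∈ 𝒲, ∀ i, ResetControl.IsBohl fun t => w t i)
    (h0 : 0 ∈ 𝒲) (hwp : S.WellPosedResets 𝒲)
    -- the base linear system is stable
    (hstable : ResetControl.IsHurwitz S.A)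
    (hcancel : ResetControl.NoPoleZeroCancellation CR G CL₁ CL₂)
    -- the Nyquist stability vector is defined at all positive frequencies
    (hpole : ∀ ω : ℝ, 0 < ω → ¬ ResetControl.HasPoleAt CR G CL₁ CL₂ ω)
    (htype :
      ResetControl.IsTypeI (ResetControl.freqs CR G CL₁ CL₂)
        (ResetControl.nsvChi CR G CL₁ CL₂ Cs) (ResetControl.nsvUpsilon CR G CL₁ CL₂)
        (ResetControl.PoleAtOrigin G CL₁ CL₂) (ResetControl.filterDC Cs) ∨
      ResetControl.IsTypeII (ResetControl.freqs CR G CL₁ CL₂)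
        (ResetControl.nsvChi CR G CL₁ CL₂ Cs) (ResetControl.nsvUpsilon CR G CL₁ CL₂)
        (ResetControl.PoleAtOrigin G CL₁ CL₂) (ResetControl.filterDC Cs)) :
    S.IsGUAS ∧ S.IsUBIBS 𝒲 := by
  subst hCR hS
  -- The choice `σ = -1` reflects Type II into Type I.
  have key : ∃ σ : ℝ, ResetControl.IsTypeI
      (ResetControl.freqs (ResetControl.sosre ξ ωr γ).toLTI G CL₁ CL₂)
      (fun ω => σ * ResetControl.nsvChi (ResetControl.sosre ξ ωr γ).toLTI G CL₁ CL₂ Cs ω)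
      (ResetControl.nsvUpsilon (ResetControl.sosre ξ ωr γ).toLTI G CL₁ CL₂)
      (ResetControl.PoleAtOrigin G CL₁ CL₂) (σ * ResetControl.filterDC Cs) := by
    rcases htype with h | h
    · exact ⟨1, by simpa only [one_mul] using h⟩
    · exact ⟨-1, by simpa only [neg_one_mul] using h.isTypeI_neg⟩
  obtain ⟨σ, hσ⟩ := key
  obtain ⟨β, hβ⟩ := ResetControl.exists_positive_real hG hCs hξ hωr hstable hcancel hpole hσ
  obtain ⟨P, hP⟩ := ResetControl.exists_certificate hγ₁ hγ₂ hξ hωr hstable hβ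
  exact ⟨hP.isGUAS, hP.isUBIBS 𝒲⟩
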